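/- **Setting.** Let $M\ge 3$, $\mathcal{M}=\{1,\dots,M\}$, $T:=\lceil M/2\rceil-1\ge 1$ and $\mathcal{C}_t:=\{\mathcal{D}\subseteq\mathcal{M}:|\mathcal{D}|=t\}$. Let $f_{\mathrm N},f_{\mathrm A}$ be probability density functions on $\mathbb{R}$ and let $k:\mathbb{R}^2\to\mathbb{R}$ be a measurable kernel function of a reproducing kernel Hilbert space (symmetric, positive semidefinite), not identically zero, with $K_0:=\sup_{x,y}k(x,y)<\infty$. Put $\mathrm{MMD}^2:=\mathsf{E}[k(X,X')]-2\mathsf{E}[k(X,Y)]+\mathsf{E}[k(Y,Y')]$ with $X,X'\sim f_{\mathrm N}$, $Y,Y'\sim f_{\mathrm A}$ independent. For finite sequences put $$\mathrm{MMD}^2(x^{n_1},y^{n_2}):=\frac{\sum_{i\ne j}k(x_i,x_j)}{n_1(n_1-1)}+\frac{\sum_{i\neq j}k(y_i,y_j)}{n_2(n_2-1)}-\frac{2\sum_{i,j}k(x_i,y_j)}{n_1n_2}.$$ We observe $M$ independent sequences of real observations. For $\mathcal{B}\subseteq\mathcal{M}$, under $\mathbb{P}_{\mathcal{B}}$ (hypothesis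 $\mathrm{H}_{\mathcal B}$) the $j$-th sequence is i.i.d. from $f_{\mathrm A}$ if $j\in\mathcal{B}$ and i.i.d. from $f_{\mathrm N}$ otherwise; $\mathbb{P}_{\mathrm r}:=\mathbb{P}_{\emptyset}$ (null hypothesis $\mathrm{H}_{\mathrm r}$). Given the first $n$ observations $y_1^n,\dots,y_M^n$ of all sequences, let $$\mathrm{G}_{\mathcal{D}}(\mathbf{y}^n):=\max_{j\notin\mathcal{D}}\mathrm{MMD}^2\big(y_j^n,\{y_i^n\}_{i\notin\mathcal{D},\,i\ne j}\big),\quad \mathcal{I}^*_t:=\operatorname*{arg\,min}_{\mathcal{D}\in\mathcal{C}_t}\mathrm{G}_{\mathcal{D}}(\mathbf{y}^n),\quad h_t(\mathbf{y}^n):=\min_{\mathcal{D}\in\mathcal{C}_t,\,\mathcal{D}\ne\mathcal{I}^*_t}\mathrm{G}_{\mathcal{D}}(\mathbf{y}^n),$$ where ties in the arg min are broken by an arbitrary fixed rule. **Sequential test.** Let $\lambda_1>\lambda_2>0$ and $N\in\mathbb{N}$. The test stops at the smallest positive integer $n\ge N-1$, denoted $\tau$ (with $\tau=\infty$ if there is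 none), such that either there is $t\in\{1,\dots,T\}$ with $h_t(\mathbf{y}^n)>\lambda_1$ and $h_{\bar t}(\mathbf{y}^n)<\lambda_2$ for all $t<\bar t\le T$, or $h_t(\mathbf{y}^n)<\lambda_2$ for all $t\in\{1,\dots,T\}$. In the first case it decides that the set of outliers is $\mathcal{I}^*_t(\mathbf{y}^\tau)$ for this (unique) $t$; otherwise it decides $\mathrm{H}_{\mathrm r}$. Let $\beta_{\mathcal{B}}$ be the $\mathbb{P}_{\mathcal B}$-probability that the decision is neither $\mathrm{H}_{\mathcal B}$ nor $\mathrm{H}_{\mathrm r}$, $\zeta_{\mathcal B}$ the $\mathbb{P}_{\mathcal B}$-probability that it is $\mathrm{H}_{\mathrm r}$, and $\mathrm{P}_{\mathrm{FA}}$ the $\mathbb{P}_{\mathrm r}$-probability that it is not $\mathrm{H}_{\mathrm r}$; they depend on $N$. For $1\le s\le T$ and $y\ge 0$ put $$\theta_s:=\Big(1-\frac{s}{M-s-1}\Big)^2\mathrm{MMD}^2,\qquad g_1(y):=\frac{y^2}{32K_0^2\big(1+\frac1{M-T-1}\big)},\qquad g_2(y):=\frac{(\theta_s-y)^2}{32K_0^2\big(1+\frac1{M-s-1}\big)}.$$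 **Theorem.** 1. For every $s$ with $1<s\le T$, for all sufficiently large $N$, $\max_{\mathcal{B}\in\mathcal{C}_s}\mathsf{E}_{\mathbb{P}_{\mathcal B}}[\tau]\le N$ if $\lambda_1<\theta_s$ (and $\le\infty$ otherwise). For $s=1$ the same holds with $\theta_s$ replaced by $\mathrm{MMD}^2$. Moreover $\mathsf{E}_{\mathbb{P}_{\mathrm r}}[\tau]\le N$ for all sufficiently large $N$. 2. If $1<s\le T$ and $\lambda_1<\theta_s$, then for each $\mathcal{B}\in\mathcal{C}_s$ $$\liminf_{N\to\infty}-\frac{\log\beta_{\mathcal B}}{\mathsf{E}_{\mathbb{P}_{\mathcal B}}[\tau]}\ge\min\{g_1(\lambda_1),g_2(\lambda_2)\},\qquad \liminf_{N\to\infty}-\frac{\log\zeta_{\mathcal B}}{\mathsf{E}_{\mathbb{P}_{\mathcal B}}[\tau]}\ge g_2(\lambda_2).$$ 3. If $\lambda_1<\mathrm{MMD}^2$, then for each $\mathcal{B}\in\mathcal{C}_1$ $$\liminf_{N\to\infty}-\frac{\log\beta_{\mathcal B}}{\mathsf{E}_{\mathbb{P}_{\mathcal B}}[\tau]}\ge g_1(\lambda_1),\qquad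 \liminf_{N\to\infty}-\frac{\log\zeta_{\mathcal B}}{\mathsf{E}_{\mathbb{P}_{\mathcal B}}[\tau]}\ge\frac{(\mathrm{MMD}^2-\lambda_2)^2}{32K_0^2\big(1+\frac1{M-2}\big)}.$$ 4. $\displaystyle\liminf_{N\to\infty}-\frac{\log \mathrm{P}_{\mathrm{FA}}}{\mathsf{E}_{\mathbb{P}_{\mathrm r}}[\tau]}\ge g_1(\lambda_1).$ Here $-\log 0=+\infty$. -/

import Mathlib

open MeasureTheory Filter
open scoped ENNReal

namespace OutlierTest

noncomputable section

/-! ### Densities, kernels and the MMD metric -/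

/-- `f` is a probability density function on the real line. -/
structure IsPDF (f : ℝ → ℝ) : Prop where
  measurable : Measurable f
  nonneg : ∀ x, 0 ≤ f x
  lintegral_eq_one : ∫⁻ x, ENNReal.ofReal (f x) = 1

/-- The probability distribution on the real line with density `f`. -/
def law (f : ℝ → ℝ) : Measure ℝ := volume.withDensity fun x => ENNReal.ofReal (f x)

/-- `k` is a (real, measurable) kernel function of a reproducing kernel Hilbert space of functions
on the real line, i.e. it is symmetric and positive semidefinite, and it is bounded above. -/
structure IsBoundedKernel (k : ℝ → ℝ → ℝ) : Prop where
  measurable : Measurable fun p : ℝ × ℝ => k p.1 p.2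
  posSemidef : (Matrix.of k).PosSemidef
  bddAbove : BddAbove (Set.range fun p : ℝ × ℝ => k p.1 p.2)

/-- The constant `K₀ = sup k(x, y)`. -/
def kernelSup (k : ℝ → ℝ → ℝ) : ℝ := ⨆ p : ℝ × ℝ, k p.1 p.2

/-- The squared MMD distance between the distributions with densities `f₁` and `f₂`:
`E k(X, X') - 2 E k(X, Y) + E k(Y, Y')` with independent `X, X' ∼ f₁` and `Y, Y' ∼ f₂`. -/
def mmdSq (k : ℝ → ℝ → ℝ) (f₁ f₂ : ℝ → ℝ) : ℝ :=
  (∫ x, ∫ x', k x x' ∂(law f₁) ∂(law f₁)) - 2 * (∫ x, ∫ y, k x y ∂(law f₂) ∂(law f₁))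
    + ∫ y, ∫ y', k y y' ∂(law f₂) ∂(law f₂)

/-- The empirical squared MMD between the finite families of reals `(z a)_{a ∈ S}` and
`(z a)_{a ∈ R}`. -/
def mmdStat {α : Type*} [DecidableEq α] (k : ℝ → ℝ → ℝ) (S R : Finset α) (z : α → ℝ) : ℝ :=
  1 / ((S.card : ℝ) * ((S.card : ℝ) - 1)) * ∑ p ∈ S.offDiag, k (z p.1) (z p.2)
    + 1 / ((R.card : ℝ) * ((R.card : ℝ) - 1)) * ∑ p ∈ R.offDiag, k (z p.1) (z p.2)
    - 2 / ((S.card : ℝ) * (R.card : ℝ)) * ∑ a ∈ S, ∑ b ∈ R, k (z a) (z b)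

/-! ### The observations -/

/-- A realization of `M` infinite sequences of real observations; `y (i, l)` is the `(l+1)`-st
observation of the `i`-th sequence. -/
abbrev Path (M : ℕ) := Fin M × ℕ → ℝ

/-- The law of the `M` sequences when `B` is the set of outliers: all observations are independent,
those of sequences `i ∈ B` have density `fA`, all the others have density `fN`.
The null hypothesis is `B = ∅`. -/
def hypLaw {M : ℕ} (fN fA : ℝ → ℝ) (B : Finset (Fin M)) : Measure (Path M) :=
  Measure.infinitePi fun a : Fin M × ℕ => if a.1 ∈ B then law fA else law fN

/-- The maximal number of outliers, `T = ⌈M / 2⌉ - 1`. -/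
def maxOutliers (M : ℕ) : ℕ := ⌈(M : ℝ) / 2⌉₊ - 1

/-- The collection `C_t` of all subsets of size `t` of the set of sequences. -/
def subsetsOfSize (M t : ℕ) : Finset (Finset (Fin M)) := Finset.powersetCard t Finset.univ

/-! ### Scoring functions -/

/-- The indices of the first `n` observations of the sequences in `D`. -/
def block {M : ℕ} (D : Finset (Fin M)) (n : ℕ) : Finset (Fin M × ℕ) := D ×ˢ Finset.range n

/-- The scoring function `G_B(y^n)`: the maximum over `j ∉ B` of the empirical squared MMD between
the `j`-th sequence and the union of all other sequences outside `B`, after `n` observations of each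
sequence. -/
def score {M : ℕ} (k : ℝ → ℝ → ℝ) (n : ℕ) (y : Path M) (B : Finset (Fin M)) : ℝ :=
  ⨆ j : {j : Fin M // j ∉ B}, mmdStat k (block {j.1} n) (block (Bᶜ.erase j.1) n) y

open Classical in
/-- The collection of all sets in `C_t` with the smallest score. -/
def minimizers {M : ℕ} (k : ℝ → ℝ → ℝ) (n : ℕ) (y : Path M) (t : ℕ) : Finset (Finset (Fin M)) :=
  (subsetsOfSize M t).filter fun D =>
    ∀ D' ∈ subsetsOfSize M t, score k n y D ≤ score k n y D'

/-- `tie` is a tie-breaking rule: it picks an element of each nonempty collection of sets. -/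
def IsTieBreak {M : ℕ} (tie : Finset (Finset (Fin M)) → Finset (Fin M)) : Prop :=
  ∀ S, S.Nonempty → tie S ∈ S

/-- `I*_t(y^n)`: the minimizer of the score over `C_t`, ties being broken by `tie`. -/
def argminScore {M : ℕ} (k : ℝ → ℝ → ℝ) (tie : Finset (Finset (Fin M)) → Finset (Fin M))
    (n : ℕ) (y : Path M) (t : ℕ) : Finset (Fin M) :=
  tie (minimizers k n y t)

/-- `h_t(y^n)`: the second smallest value of the score over `C_t`. -/
def secondScore {M : ℕ} (k : ℝ → ℝ → ℝ) (tie : Finset (Finset (Fin M)) → Finset (Fin M))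
    (n : ℕ) (y : Path M) (t : ℕ) : ℝ :=
  ⨅ D : {D : Finset (Fin M) // D ∈ subsetsOfSize M t ∧ D ≠ argminScore k tie n y t},
    score k n y D.1

/-! ### The sequential test -/

/-- The condition `h_t(y^n) > λ₁` and `h_t'(y^n) < λ₂` for all `t' ∈ [t+1 : T]`. -/
def Selects {M : ℕ} (k : ℝ → ℝ → ℝ) (tie : Finset (Finset (Fin M)) → Finset (Fin M))
    (lam1 lam2 : ℝ) (n : ℕ) (y : Path M) (t : ℕ) : Prop :=
  lam1 < secondScore k tie n y t ∧
    ∀ t' ∈ Finset.Icc (t + 1) (maxOutliers M), secondScore k tie n y t' < lam2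

/-- The stopping time `τ`, with value `⊤` if the test never stops. -/
def stopTime {M : ℕ} (k : ℝ → ℝ → ℝ) (tie : Finset (Finset (Fin M)) → Finset (Fin M))
    (lam1 lam2 : ℝ) (N : ℕ) (y : Path M) : ℕ∞ :=
  sInf ((fun n : ℕ => (n : ℕ∞)) '' {n : ℕ | 1 ≤ n ∧ N ≤ n + 1 ∧
    ((∃ t ∈ Finset.Icc 1 (maxOutliers M), Selects k tie lam1 lam2 n y t) ∨
      ∀ t ∈ Finset.Icc 1 (maxOutliers M), secondScore k tie n y t < lam2)})

open Classical in
/-- The estimated number of outliers: the `t ∈ [T]` with `Selects … t` (there is at most one if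
`λ₂ ≤ λ₁`), and `0` if there is none. -/
def estNum {M : ℕ} (k : ℝ → ℝ → ℝ) (tie : Finset (Finset (Fin M)) → Finset (Fin M))
    (lam1 lam2 : ℝ) (n : ℕ) (y : Path M) : ℕ :=
  ((Finset.Icc 1 (maxOutliers M)).filter fun t => Selects k tie lam1 lam2 n y t).sup id

/-- The decision after `n` observations of each sequence: `none` stands for `H_r` (no outliers) and
`some D` for `H_D` (the set of outliers is `D`). -/
def decision {M : ℕ} (k : ℝ → ℝ → ℝ) (tie : Finset (Finset (Fin M)) → Finset (Fin M))
    (lam1 lam2 : ℝ) (n : ℕ) (y : Path M) : Option (Finset (Fin M)) :=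
  if estNum k tie lam1 lam2 n y = 0 then none
  else some (argminScore k tie n y (estNum k tie lam1 lam2 n y))

/-- The expected stopping time under the hypothesis that `B` is the set of outliers. -/
def expStop {M : ℕ} (k : ℝ → ℝ → ℝ) (tie : Finset (Finset (Fin M)) → Finset (Fin M))
    (lam1 lam2 : ℝ) (fN fA : ℝ → ℝ) (B : Finset (Fin M)) (N : ℕ) : ℝ≥0∞ :=
  ∫⁻ y, (stopTime k tie lam1 lam2 N y : ℝ≥0∞) ∂(hypLaw fN fA B)

/-- The probability, when `B` is the set of outliers, that the test stops with a decision
in `A`. -/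
def probDecide {M : ℕ} (k : ℝ → ℝ → ℝ) (tie : Finset (Finset (Fin M)) → Finset (Fin M))
    (lam1 lam2 : ℝ) (fN fA : ℝ → ℝ) (B : Finset (Fin M)) (A : Set (Option (Finset (Fin M))))
    (N : ℕ) : ℝ≥0∞ :=
  hypLaw fN fA B
    {y | ∃ n : ℕ, stopTime k tie lam1 lam2 N y = n ∧ decision k tie lam1 lam2 n y ∈ A}

/-- The misclassification probability `β_B` of the sequential test. -/
def misclassProb {M : ℕ} (k : ℝ → ℝ → ℝ) (tie : Finset (Finset (Fin M)) → Finset (Fin M))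
    (lam1 lam2 : ℝ) (fN fA : ℝ → ℝ) (B : Finset (Fin M)) (N : ℕ) : ℝ≥0∞ :=
  probDecide k tie lam1 lam2 fN fA B {d | d ≠ some B ∧ d ≠ none} N

/-- The false reject probability `ζ_B` of the sequential test. -/
def falseRejectProb {M : ℕ} (k : ℝ → ℝ → ℝ) (tie : Finset (Finset (Fin M)) → Finset (Fin M))
    (lam1 lam2 : ℝ) (fN fA : ℝ → ℝ) (B : Finset (Fin M)) (N : ℕ) : ℝ≥0∞ :=
  probDecide k tie lam1 lam2 fN fA B {d | d = none} N

/-- The false alarm probability of the sequential test. -/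
def falseAlarmProb {M : ℕ} (k : ℝ → ℝ → ℝ) (tie : Finset (Finset (Fin M)) → Finset (Fin M))
    (lam1 lam2 : ℝ) (fN fA : ℝ → ℝ) (N : ℕ) : ℝ≥0∞ :=
  probDecide k tie lam1 lam2 fN fA (∅ : Finset (Fin M)) {d | d ≠ none} N

/-! ### Exponents -/

/-- `liminf_{N → ∞} -(1 / e N) log (p N)`, in the extended reals (so `-log 0 = ⊤`). -/
def exponent (p e : ℕ → ℝ≥0∞) : EReal :=
  liminf (fun N : ℕ => -ENNReal.log (p N) / ((e N : ℝ≥0∞) : EReal)) atTop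

/-- The threshold `(1 - s / (M - s - 1))² MMD²(fN, fA)`. -/
def threshold (k : ℝ → ℝ → ℝ) (M s : ℕ) (fN fA : ℝ → ℝ) : ℝ :=
  (1 - (s : ℝ) / ((M : ℝ) - s - 1)) ^ 2 * mmdSq k fN fA

/-- The exponent function `g₁`. -/
def g1 (k : ℝ → ℝ → ℝ) (M : ℕ) (x : ℝ) : ℝ :=
  x ^ 2 / (32 * kernelSup k ^ 2 * (1 + 1 / ((M : ℝ) - (maxOutliers M : ℝ) - 1)))

/-- The exponent function `g₂` for `s` outliers. -/
def g2 (k : ℝ → ℝ → ℝ) (M s : ℕ) (fN fA : ℝ → ℝ) (x : ℝ) : ℝ :=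
  (threshold k M s fN fA - x) ^ 2 / (32 * kernelSup k ^ 2 * (1 + 1 / ((M : ℝ) - s - 1)))

end

end OutlierTest

/-!
The empirical squared MMD of two families of observations is a function with bounded differences:
as `|k| ≤ K₀`, replacing one observation of a family of size `n` moves it by at most `8 K₀ / n`.
McDiarmid's inequality (`hasSubgaussianMGF_of_boundedDifferences`), proved for infinite product
measures by resampling one coordinate at a time, therefore bounds the probability that it deviates
from its mean by `ε` after `n` observations of each sequence by
`exp (-n ε² / (32 K₀² (1 + 1 / r)))`, where `r` is the number of sequences that the `j`-th one is
compared with. The mean is computed exactly (`integral_mmdStat`). It is zero if all sequences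
involved are nominal, and if the `j`-th sequence is an outlier and `v` of the `r` others are
nominal, then it tends to `(v / r)² MMD²`.

So two kinds of events have exponentially small probability when `B` is the set of outliers:
* `nominalExceeds`: for some set `D ⊇ B` a statistic of the sequences outside `D` is large
  (`expSmall_nominalExceeds`);
* `outlierBelow`: for some `D ≠ B` of the size `s` of `B` the statistic of an outlier outside `D` is
  small (`expSmall_outlierBelow`). At most `s - 1` of the `M - s - 1` other sequences are outliers,
  so the limiting mean is at least `(1 - (s - 1) / (M - s - 1))² MMD²`, which is `MMD²` for `s = 1`
  and at least the threshold of the theorem otherwise.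

Everything else is deterministic. Off these events the test stops (`stopsAt_of_notMem`), so the
expected delay beyond `N - 1` is the tail of a convergent geometric series and is at most one for
large `N` (`expStop_le_of_expSmall`). A wrong decision at time `n` entails one of these events at
time `n` (`mem_of_misclassification`), so the error probabilities are bounded by such tails too, and
division by an expected stopping time of at most `N` yields the exponents
(`le_exponent_probDecide`).
-/

namespace OutlierTest

/-! ### McDiarmid's inequality on product spaces -/

theorem integrable_of_abs_le {Ω : Type*} [MeasurableSpace Ω] {P : Measure Ω} [IsFiniteMeasure P]
    {f : Ω → ℝ} (hf : Measurable f) {C : ℝ} (hC : ∀ y, |f y| ≤ C) : Integrable f P :=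
  Integrable.of_bound hf.aestronglyMeasurable C (ae_of_all _ hC)

theorem abs_integral_le_of_abs_le {Ω : Type*} [MeasurableSpace Ω] {P : Measure Ω}
    [IsProbabilityMeasure P] {f : Ω → ℝ} {C : ℝ} (hC : ∀ y, |f y| ≤ C) : |∫ y, f y ∂P| ≤ C := by
  simpa using norm_integral_le_of_norm_le_const (μ := P) (f := f) (C := C) (ae_of_all _ hC)

section BoundedDifferences

variable {ι : Type*} [DecidableEq ι] {X : ι → Type*} [∀ i, MeasurableSpace (X i)]
  (μ : ∀ i, Measure (X i)) [∀ i, IsProbabilityMeasure (μ i)]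

/-- Resampling one coordinate of a product measure does not change its law. -/
theorem infinitePi_map_update (a : ι) :
    ((Measure.infinitePi μ).prod (μ a)).map (fun p => Function.update p.1 a p.2)
      = Measure.infinitePi μ := by
  refine Measure.eq_infinitePi μ fun s t ht => ?_
  rw [Measure.map_apply measurable_update' (MeasurableSet.pi s.countable_toSet fun i _ => ht i)]
  have hpre : (fun p : (∀ i, X i) × X a => Function.update p.1 a p.2) ⁻¹' (Set.pi s t)
      = (Set.pi (s.erase a : Finset ι) t) ×ˢ (if a ∈ s then t a else Set.univ) := by
    ext ⟨y, x⟩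
    simp only [Set.mem_preimage, Set.mem_pi, Set.mem_prod, Finset.mem_coe, Finset.mem_erase]
    constructor
    · intro h
      refine ⟨fun i hi => by simpa [hi.1] using h i hi.2, ?_⟩
      split_ifs with ha
      · simpa using h a ha
      · trivial
    · rintro ⟨h1, h2⟩ i hi
      by_cases hia : i = a
      · subst hia; simpa [hi] using h2
      · simpa [hia] using h1 i ⟨hia, hi⟩
  rw [hpre, Measure.prod_prod, Measure.infinitePi_pi μ fun i _ => ht i]
  split_ifs with ha
  · rw [mul_comm, Finset.mul_prod_erase s (fun i => μ i (t i)) ha]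
  · simp [Finset.erase_eq_of_notMem ha]

theorem integral_infinitePi_eq_integral_update (a : ι) {f : (∀ i, X i) → ℝ}
    (hf : Integrable f (Measure.infinitePi μ)) :
    ∫ y, f y ∂(Measure.infinitePi μ)
      = ∫ y, ∫ x, f (Function.update y a x) ∂(μ a) ∂(Measure.infinitePi μ) := by
  have hmap := infinitePi_map_update μ a
  rw [← hmap] at hf
  conv_lhs => rw [← hmap]
  rw [integral_map measurable_update'.aemeasurable hf.aestronglyMeasurable]
  exact integral_prod _ (hf.comp_measurable measurable_update')

/-- Hoeffding's lemma for a function of oscillation at most `c`. -/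
theorem integral_exp_le_of_oscillation {Ω : Type*} [MeasurableSpace Ω] {P : Measure Ω}
    [IsProbabilityMeasure P] {f : Ω → ℝ} (hf : Measurable f) {c : ℝ}
    (hc : ∀ x x', f x - f x' ≤ c) (t : ℝ) :
    ∫ x, Real.exp (t * f x) ∂P ≤ Real.exp (t * ∫ x, f x ∂P + (c / 2) ^ 2 * t ^ 2 / 2) := by
  have : Nonempty Ω := nonempty_of_isProbabilityMeasure P
  obtain ⟨x₀⟩ := this
  have hbdd : BddBelow (Set.range f) := ⟨f x₀ - c, by
    rintro _ ⟨x, rfl⟩; linarith [hc x₀ x]⟩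
  have : Nonempty Ω := ⟨x₀⟩
  have hmem : ∀ x, f x ∈ Set.Icc (⨅ x, f x) ((⨅ x, f x) + c) := fun x =>
    ⟨ciInf_le hbdd x, by
      have : f x - c ≤ ⨅ x, f x := le_ciInf fun x' => by linarith [hc x x']
      linarith⟩
  have h := (ProbabilityTheory.hasSubgaussianMGF_of_mem_Icc (μ := P) hf.aemeasurable
    (ae_of_all _ hmem)).mgf_le t
  have hsplit : ∀ x, Real.exp (t * f x)
      = Real.exp (t * ∫ x, f x ∂P) * Real.exp (t * (f x - ∫ x, f x ∂P)) := fun x => by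
    rw [← Real.exp_add]; ring_nf
  simp_rw [hsplit]
  rw [integral_const_mul, Real.exp_add]
  gcongr
  refine h.trans (le_of_eq ?_)
  congr 1
  simp [div_pow]

/-- The exponential moment bound behind McDiarmid's inequality. The coordinates of `S` are
integrated out one at a time, each at the price given by Hoeffding's lemma. -/
theorem integral_exp_le_of_boundedDifferences (S : Finset ι) (c : ι → ℝ) (t : ℝ)
    {f : (∀ i, X i) → ℝ} (hf : Measurable f) (hdep : DependsOn f (S : Set ι))
    {C : ℝ} (hC : ∀ y, |f y| ≤ C)
    (hc : ∀ a ∈ S, ∀ y x, |f (Function.update y a x) - f y| ≤ c a) :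
    ∫ y, Real.exp (t * f y) ∂(Measure.infinitePi μ)
      ≤ Real.exp (t * ∫ y, f y ∂(Measure.infinitePi μ)
          + (∑ a ∈ S, (c a / 2) ^ 2) * t ^ 2 / 2) := by
  induction S using Finset.induction_on generalizing f with
  | empty =>
    obtain ⟨y₀⟩ : Nonempty (∀ i, X i) := nonempty_of_isProbabilityMeasure (Measure.infinitePi μ)
    have : ∀ y, f y = f y₀ := fun y => hdep (by simp)
    simp [this]
  | insert a S ha ih =>
    have hupd : ∀ y, Measurable fun x => f (Function.update y a x) := fun y =>
      hf.comp (measurable_update y)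
    have hfint : ∀ y, Integrable (fun x => f (Function.update y a x)) (μ a) := fun y =>
      integrable_of_abs_le (hupd y) fun x => hC _
    set g : (∀ i, X i) → ℝ := fun y => ∫ x, f (Function.update y a x) ∂(μ a) with hg
    have hgm : Measurable g :=
      (StronglyMeasurable.integral_prod_right' (ν := μ a)
        (f := fun p : (∀ i, X i) × X a => f (Function.update p.1 a p.2))
        (hf.comp measurable_update').stronglyMeasurable).measurable
    have hgC : ∀ y, |g y| ≤ C := fun y => abs_integral_le_of_abs_le fun x => hC _
    have hgdep : DependsOn g (S : Set ι) := fun y y' h => by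
      refine integral_congr_ae (ae_of_all _ fun x => hdep fun i hi => ?_)
      by_cases hia : i = a
      · subst hia; simp
      · simpa [hia] using h i (by simpa [hia] using hi)
    have hgc : ∀ b ∈ S, ∀ y x, |g (Function.update y b x) - g y| ≤ c b := fun b hb y x => by
      have hba : b ≠ a := fun h => ha (h ▸ hb)
      rw [hg, ← integral_sub (hfint _) (hfint _)]
      refine abs_integral_le_of_abs_le fun z => ?_
      rw [Function.update_comm hba]
      exact hc b (Finset.mem_insert_of_mem hb) _ _
    have hexp : ∀ y, Real.exp (t * f y) ≤ Real.exp (|t| * C) := fun y => by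
      refine Real.exp_le_exp.2 ((le_abs_self _).trans ?_)
      rw [abs_mul]
      exact mul_le_mul_of_nonneg_left (hC y) (abs_nonneg t)
    have hgexp : ∀ y, Real.exp (t * g y) ≤ Real.exp (|t| * C) := fun y => by
      refine Real.exp_le_exp.2 ((le_abs_self _).trans ?_)
      rw [abs_mul]
      exact mul_le_mul_of_nonneg_left (hgC y) (abs_nonneg t)
    have hem : Measurable fun y => Real.exp (t * f y) := (hf.const_mul t).exp
    have hei : Integrable (fun y => Real.exp (t * f y)) (Measure.infinitePi μ) :=
      integrable_of_abs_le hem fun y => by rw [abs_of_pos (Real.exp_pos _)]; exact hexp y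
    have hgei : Integrable (fun y => Real.exp (t * g y)) (Measure.infinitePi μ) :=
      integrable_of_abs_le (hgm.const_mul t).exp fun y => by
        rw [abs_of_pos (Real.exp_pos _)]; exact hgexp y
    have hfg : ∫ y, g y ∂(Measure.infinitePi μ) = ∫ y, f y ∂(Measure.infinitePi μ) :=
      (integral_infinitePi_eq_integral_update μ a (integrable_of_abs_le hf hC)).symm
    have hstep : ∀ y, ∫ x, Real.exp (t * f (Function.update y a x)) ∂(μ a)
        ≤ Real.exp ((c a / 2) ^ 2 * t ^ 2 / 2) * Real.exp (t * g y) := fun y => by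
      rw [← Real.exp_add, add_comm]
      refine integral_exp_le_of_oscillation (hupd y) (fun x x' => ?_) t
      have := hc a (Finset.mem_insert_self a S) (Function.update y a x') x
      rw [Function.update_idem] at this
      exact (le_abs_self _).trans this
    rw [integral_infinitePi_eq_integral_update μ a hei]
    calc _ ≤ ∫ y, Real.exp ((c a / 2) ^ 2 * t ^ 2 / 2) * Real.exp (t * g y)
              ∂(Measure.infinitePi μ) := by
          refine integral_mono ?_ (hgei.const_mul _) hstep
          refine integrable_of_abs_le (C := Real.exp (|t| * C))
            (StronglyMeasurable.integral_prod_right' (ν := μ a)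
              (f := fun p : (∀ i, X i) × X a => Real.exp (t * f (Function.update p.1 a p.2)))
              (hem.comp measurable_update').stronglyMeasurable).measurable fun y => ?_
          refine abs_integral_le_of_abs_le fun x => ?_
          rw [abs_of_pos (Real.exp_pos _)]
          exact hexp _
      _ ≤ _ := by
          rw [integral_const_mul]
          refine (mul_le_mul_of_nonneg_left (ih hgm hgdep hgC hgc) (Real.exp_pos _).le).trans
            (le_of_eq ?_)
          rw [← Real.exp_add, hfg, Finset.sum_insert ha]
          ring_nf

/-- **McDiarmid's inequality**: a bounded function of finitely many independent random variables
that varies by at most `c a` with the `a`-th of them is sub-Gaussian around its mean. -/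
theorem hasSubgaussianMGF_of_boundedDifferences (S : Finset ι) (c : ι → ℝ) {V : ℝ}
    {f : (∀ i, X i) → ℝ} (hf : Measurable f) (hdep : DependsOn f (S : Set ι))
    {C : ℝ} (hC : ∀ y, |f y| ≤ C)
    (hc : ∀ a ∈ S, ∀ y x, |f (Function.update y a x) - f y| ≤ c a)
    (hV : ∑ a ∈ S, (c a / 2) ^ 2 ≤ V) :
    ProbabilityTheory.HasSubgaussianMGF (fun y => f y - ∫ y, f y ∂(Measure.infinitePi μ))
      V.toNNReal (Measure.infinitePi μ) := by
  have hV0 : 0 ≤ V := (Finset.sum_nonneg fun a _ => sq_nonneg (c a / 2)).trans hV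
  have hsplit : ∀ t y, Real.exp (t * (f y - ∫ y, f y ∂(Measure.infinitePi μ)))
      = Real.exp (-(t * ∫ y, f y ∂(Measure.infinitePi μ))) * Real.exp (t * f y) := fun t y => by
    rw [← Real.exp_add]; ring_nf
  refine ⟨fun t => ?_, fun t => ?_⟩
  · simp_rw [hsplit]
    refine (integrable_of_abs_le (C := Real.exp (|t| * C)) (hf.const_mul t).exp
      fun y => ?_).const_mul _
    rw [abs_of_pos (Real.exp_pos _)]
    refine Real.exp_le_exp.2 ((le_abs_self _).trans ?_)
    rw [abs_mul]
    exact mul_le_mul_of_nonneg_left (hC y) (abs_nonneg t)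
  · unfold ProbabilityTheory.mgf
    simp_rw [hsplit]
    rw [integral_const_mul]
    refine (mul_le_mul_of_nonneg_left (integral_exp_le_of_boundedDifferences μ S c t hf hdep hC hc)
      (Real.exp_pos _).le).trans ?_
    rw [← Real.exp_add, Real.coe_toNNReal _ hV0]
    refine Real.exp_le_exp.2 ?_
    have := mul_le_mul_of_nonneg_right hV (sq_nonneg t)
    linarith

end BoundedDifferences

/-! ### Kernels -/

section Kernel

variable {k : ℝ → ℝ → ℝ}

theorem IsBoundedKernel.symm (hk : IsBoundedKernel k) (x y : ℝ) : k x y = k y x := by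
  simpa using hk.posSemidef.isHermitian.apply y x

theorem IsBoundedKernel.le_kernelSup (hk : IsBoundedKernel k) (x y : ℝ) : k x y ≤ kernelSup k :=
  le_ciSup hk.bddAbove (x, y)

theorem IsBoundedKernel.abs_le_kernelSup (hk : IsBoundedKernel k) (x y : ℝ) :
    |k x y| ≤ kernelSup k := by
  have h := (hk.posSemidef.submatrix ![x, y]).dotProduct_mulVec_nonneg ![1, 1]
  have h' := (hk.posSemidef.submatrix ![x, y]).dotProduct_mulVec_nonneg ![1, -1]
  simp [dotProduct, Matrix.mulVec, Fin.sum_univ_two, hk.symm y x] at h h'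
  have hx := hk.le_kernelSup x x
  have hy := hk.le_kernelSup y y
  rw [abs_le]
  constructor <;> linarith

theorem measurable_kernel_comp {α : Type*} (hk : IsBoundedKernel k)
    (a b : α) :
    Measurable fun z : α → ℝ => k (z a) (z b) :=
  hk.measurable.comp (f := fun z : α → ℝ => (z a, z b))
    ((measurable_pi_apply a).prodMk (measurable_pi_apply b))

/-- The mean `E k(X, Y)` for independent `X ∼ P` and `Y ∼ Q`. -/
noncomputable def kernelMean (k : ℝ → ℝ → ℝ) (P Q : Measure ℝ) : ℝ := ∫ x, ∫ y, k x y ∂Q ∂P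

theorem IsBoundedKernel.integrable_prod (hk : IsBoundedKernel k) (P Q : Measure ℝ)
    [IsProbabilityMeasure P] [IsProbabilityMeasure Q] :
    Integrable (fun p : ℝ × ℝ => k p.1 p.2) (P.prod Q) :=
  integrable_of_abs_le hk.measurable fun p => hk.abs_le_kernelSup p.1 p.2

theorem IsBoundedKernel.kernelMean_comm (hk : IsBoundedKernel k) (P Q : Measure ℝ)
    [IsProbabilityMeasure P] [IsProbabilityMeasure Q] : kernelMean k P Q = kernelMean k Q P := by
  unfold kernelMean
  rw [integral_integral_swap (hk.integrable_prod P Q)]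
  simp_rw [hk.symm]

theorem IsBoundedKernel.mmdSq_comm (hk : IsBoundedKernel k) (f₁ f₂ : ℝ → ℝ)
    [IsProbabilityMeasure (law f₁)] [IsProbabilityMeasure (law f₂)] :
    mmdSq k f₁ f₂ = mmdSq k f₂ f₁ := by
  have := hk.kernelMean_comm (law f₁) (law f₂)
  unfold kernelMean at this
  unfold mmdSq
  linarith

end Kernel

/-! ### The empirical squared MMD -/

section Statistic

variable {α : Type*} [DecidableEq α] {k : ℝ → ℝ → ℝ}

theorem sum_offDiag_add_sum_diag (S : Finset α) (F : α → α → ℝ) :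
    ∑ p ∈ S.offDiag, F p.1 p.2 + ∑ x ∈ S, F x x = ∑ x ∈ S, ∑ y ∈ S, F x y := by
  rw [← Finset.sum_product' S S F, ← Finset.diag_union_offDiag S,
    Finset.sum_union (Finset.disjoint_diag_offDiag S), Finset.sum_diag S fun p => F p.1 p.2,
    add_comm]

theorem IsBoundedKernel.mmdStat_comm (hk : IsBoundedKernel k) (S R : Finset α) (z : α → ℝ) :
    mmdStat k S R z = mmdStat k R S z := by
  unfold mmdStat
  rw [Finset.sum_comm, mul_comm (S.card : ℝ) R.card]
  simp_rw [fun a b => hk.symm (z a) (z b)]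
  ring

theorem measurable_mmdStat (hk : IsBoundedKernel k) (S R : Finset α) :
    Measurable (mmdStat k S R) := by
  have h := fun a b : α => measurable_kernel_comp hk a b
  have hoff : ∀ W : Finset (α × α), Measurable fun z : α → ℝ => ∑ p ∈ W, k (z p.1) (z p.2) :=
    fun W => Finset.measurable_fun_sum W fun p _ => h p.1 p.2
  have hcross : Measurable fun z : α → ℝ => ∑ a ∈ S, ∑ b ∈ R, k (z a) (z b) :=
    Finset.measurable_fun_sum S fun a _ => Finset.measurable_fun_sum R fun b _ => h a b
  exact (((hoff _).const_mul _).add ((hoff _).const_mul _)).sub (hcross.const_mul _)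

theorem dependsOn_mmdStat (S R : Finset α) :
    DependsOn (mmdStat k S R) ((S ∪ R : Finset α) : Set α) := by
  intro y y' h
  have hS : ∀ a ∈ S, y a = y' a := fun a ha => h a (by simp [ha])
  have hR : ∀ a ∈ R, y a = y' a := fun a ha => h a (by simp [ha])
  have hoff : ∀ W : Finset α, (∀ a ∈ W, y a = y' a) →
      ∑ p ∈ W.offDiag, k (y p.1) (y p.2) = ∑ p ∈ W.offDiag, k (y' p.1) (y' p.2) :=
    fun W hW => Finset.sum_congr rfl fun p hp => by
      rw [Finset.mem_offDiag] at hp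
      rw [hW _ hp.1, hW _ hp.2.1]
  have hcross : ∑ a ∈ S, ∑ b ∈ R, k (y a) (y b) = ∑ a ∈ S, ∑ b ∈ R, k (y' a) (y' b) :=
    Finset.sum_congr rfl fun a ha => Finset.sum_congr rfl fun b hb => by rw [hS _ ha, hR _ hb]
  simp only [mmdStat, hoff S hS, hoff R hR, hcross]

theorem exists_abs_mmdStat_le {K : ℝ} (hK : ∀ x y, |k x y| ≤ K) (S R : Finset α) :
    ∃ C, ∀ z, |mmdStat k S R z| ≤ C := by
  refine ⟨|1 / ((S.card : ℝ) * ((S.card : ℝ) - 1))| * ∑ p ∈ S.offDiag, K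
    + |1 / ((R.card : ℝ) * ((R.card : ℝ) - 1))| * ∑ p ∈ R.offDiag, K
    + |2 / ((S.card : ℝ) * (R.card : ℝ))| * ∑ a ∈ S, ∑ b ∈ R, K, fun z => ?_⟩
  unfold mmdStat
  refine (abs_sub _ _).trans (add_le_add ((abs_add_le _ _).trans (add_le_add ?_ ?_)) ?_) <;>
  rw [abs_mul] <;> refine mul_le_mul_of_nonneg_left ?_ (abs_nonneg _)
  · exact (Finset.abs_sum_le_sum_abs _ _).trans (Finset.sum_le_sum fun p _ => hK _ _)
  · exact (Finset.abs_sum_le_sum_abs _ _).trans (Finset.sum_le_sum fun p _ => hK _ _)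
  · exact (Finset.abs_sum_le_sum_abs _ _).trans (Finset.sum_le_sum fun p _ =>
      (Finset.abs_sum_le_sum_abs _ _).trans (Finset.sum_le_sum fun p _ => hK _ _))

theorem abs_sum_offDiag_update_sub_le {K : ℝ} (hK : ∀ x y, |k x y| ≤ K) {S : Finset α} {a : α}
    (ha : a ∈ S) (z : α → ℝ) (x : ℝ) :
    |∑ p ∈ S.offDiag, k (Function.update z a x p.1) (Function.update z a x p.2)
      - ∑ p ∈ S.offDiag, k (z p.1) (z p.2)| ≤ 4 * K * ((S.card : ℝ) - 1) := by
  have hK0 : 0 ≤ K := (abs_nonneg _).trans (hK 0 0)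
  have h1 : S.offDiag.filter (fun p => p.1 = a) = {a} ×ˢ S.erase a := by
    ext ⟨p, q⟩; simp only [Finset.mem_filter, Finset.mem_offDiag, Finset.mem_product,
      Finset.mem_singleton, Finset.mem_erase]; grind
  have h2 : S.offDiag.filter (fun p => p.2 = a) = S.erase a ×ˢ {a} := by
    ext ⟨p, q⟩; simp only [Finset.mem_filter, Finset.mem_offDiag, Finset.mem_product,
      Finset.mem_singleton, Finset.mem_erase]; grind
  have hcard : ((S.erase a).card : ℝ) = (S.card : ℝ) - 1 := by
    rw [Finset.card_erase_of_mem ha, Nat.cast_sub (Finset.card_pos.2 ⟨a, ha⟩), Nat.cast_one]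
  calc _ ≤ ∑ p ∈ S.offDiag, |k (Function.update z a x p.1) (Function.update z a x p.2)
        - k (z p.1) (z p.2)| := by
        rw [← Finset.sum_sub_distrib]; exact Finset.abs_sum_le_sum_abs _ _
    _ ≤ ∑ p ∈ S.offDiag, ((if p.1 = a then 2 * K else 0) + if p.2 = a then 2 * K else 0) := by
        refine Finset.sum_le_sum fun p _ => ?_
        have hb : |k (Function.update z a x p.1) (Function.update z a x p.2)
          - k (z p.1) (z p.2)| ≤ 2 * K := by
            have := hK (Function.update z a x p.1) (Function.update z a x p.2)
            have := hK (z p.1) (z p.2)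
            exact (abs_sub _ _).trans (by linarith)
        by_cases hp1 : p.1 = a
        · rw [if_pos hp1]
          have : (0 : ℝ) ≤ if p.2 = a then 2 * K else 0 := by split_ifs <;> linarith
          linarith
        · by_cases hp2 : p.2 = a
          · rw [if_neg hp1, if_pos hp2]; linarith
          · simp [hp1, hp2]
    _ = _ := by
        rw [Finset.sum_add_distrib, ← Finset.sum_filter, ← Finset.sum_filter, h1, h2]
        simp only [Finset.sum_const, Finset.card_product, Finset.card_singleton, one_mul, mul_one,
          nsmul_eq_mul, hcard]
        ring

theorem abs_mmdStat_update_sub_le {K : ℝ} (hK : ∀ x y, |k x y| ≤ K) {S R : Finset α}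
    (hSR : Disjoint S R) {a : α} (ha : a ∈ S) (z : α → ℝ) (x : ℝ) :
    |mmdStat k S R (Function.update z a x) - mmdStat k S R z| ≤ 8 * K / S.card := by
  have hK0 : 0 ≤ K := (abs_nonneg _).trans (hK 0 0)
  have haR : a ∉ R := Finset.disjoint_left.1 hSR ha
  have hne : ∀ b ∈ R, Function.update z a x b = z b := fun b hb =>
    Function.update_of_ne (by rintro rfl; exact haR hb) _ _
  have hS0 : (1 : ℝ) ≤ S.card := by exact_mod_cast Finset.card_pos.2 ⟨a, ha⟩
  have hRR : ∑ p ∈ R.offDiag, k (Function.update z a x p.1) (Function.update z a x p.2)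
      = ∑ p ∈ R.offDiag, k (z p.1) (z p.2) := by
    refine Finset.sum_congr rfl fun p hp => ?_
    rw [Finset.mem_offDiag] at hp
    rw [hne _ hp.1, hne _ hp.2.1]
  have hcross : |∑ b ∈ S, ∑ c ∈ R, k (Function.update z a x b) (Function.update z a x c)
      - ∑ b ∈ S, ∑ c ∈ R, k (z b) (z c)| ≤ 2 * K * R.card := by
    rw [← Finset.sum_sub_distrib, Finset.sum_eq_single_of_mem a ha, ← Finset.sum_sub_distrib]
    · refine (Finset.abs_sum_le_sum_abs _ _).trans ((Finset.sum_le_sum (g := fun _ => 2 * K)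
        fun c _ => ?_).trans (by simp [mul_comm]))
      have h1 := hK (Function.update z a x a) (Function.update z a x c)
      have h2 := hK (z a) (z c)
      exact (abs_sub _ _).trans (by linarith)
    · intro b _ hba
      rw [sub_eq_zero]
      refine Finset.sum_congr rfl fun c hc => ?_
      rw [hne c hc, Function.update_of_ne hba]
  have hdiag := abs_sum_offDiag_update_sub_le hK ha z x
  unfold mmdStat
  rw [hRR]
  set A' := ∑ p ∈ S.offDiag, k (Function.update z a x p.1) (Function.update z a x p.2)
  set A := ∑ p ∈ S.offDiag, k (z p.1) (z p.2)
  set C' := ∑ b ∈ S, ∑ c ∈ R, k (Function.update z a x b) (Function.update z a x c)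
  set C := ∑ b ∈ S, ∑ c ∈ R, k (z b) (z c)
  set n : ℝ := (S.card : ℝ)
  have hr0 : (0 : ℝ) ≤ R.card := Nat.cast_nonneg _
  set r : ℝ := (R.card : ℝ)
  have e1 : |1 / (n * (n - 1)) * (A' - A)| ≤ 4 * K / n := by
    rw [abs_mul, abs_of_nonneg (by
      exact div_nonneg zero_le_one (mul_nonneg (by linarith) (by linarith)))]
    rcases eq_or_lt_of_le hS0 with h | h
    · rw [← h]; simp; exact hK0
    · calc _ ≤ 1 / (n * (n - 1)) * (4 * K * (n - 1)) := by gcongr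
        _ = 4 * K / n := by
          have : n - 1 ≠ 0 := by linarith
          field_simp
  have e2 : |2 / (n * r) * (C' - C)| ≤ 4 * K / n := by
    rw [abs_mul, abs_of_nonneg (by positivity)]
    rcases eq_or_lt_of_le hr0 with h | h
    · rw [← h]; simp; positivity
    · calc _ ≤ 2 / (n * r) * (2 * K * r) := by gcongr
        _ = 4 * K / n := by field_simp; ring
  calc _ = |1 / (n * (n - 1)) * (A' - A) - 2 / (n * r) * (C' - C)| := by congr 1; ring
    _ ≤ 4 * K / n + 4 * K / n := (abs_sub _ _).trans (add_le_add e1 e2)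
    _ = _ := by ring

variable (μ : α → Measure ℝ) [∀ a, IsProbabilityMeasure (μ a)]

/-- McDiarmid's inequality applies to the empirical squared MMD: as `|k| ≤ K`, an observation in a
family of size `n` changes it by at most `8 K / n`. -/
theorem hasSubgaussianMGF_mmdStat (hk : IsBoundedKernel k) {K : ℝ} (hK : ∀ x y, |k x y| ≤ K)
    {S R : Finset α} (hSR : Disjoint S R) (hS : S.Nonempty) (hR : R.Nonempty) :
    ProbabilityTheory.HasSubgaussianMGF
      (fun z => mmdStat k S R z - ∫ z, mmdStat k S R z ∂(Measure.infinitePi μ))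
      (16 * K ^ 2 * (1 / (S.card : ℝ) + 1 / (R.card : ℝ))).toNNReal (Measure.infinitePi μ) := by
  obtain ⟨C, hC⟩ := exists_abs_mmdStat_le hK S R
  refine hasSubgaussianMGF_of_boundedDifferences μ (S ∪ R)
    (fun a => if a ∈ S then 8 * K / S.card else 8 * K / R.card) (measurable_mmdStat hk S R)
    (dependsOn_mmdStat S R) hC (fun a ha y x => ?_) (le_of_eq ?_)
  · by_cases haS : a ∈ S
    · simpa [haS] using abs_mmdStat_update_sub_le hK hSR haS y x
    · have haR : a ∈ R := (Finset.mem_union.1 ha).resolve_left haS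
      rw [hk.mmdStat_comm S R, hk.mmdStat_comm S R]
      simpa [haS] using abs_mmdStat_update_sub_le hK hSR.symm haR y x
  · have hS0 : (S.card : ℝ) ≠ 0 := by simpa using hS.ne_empty
    have hR0 : (R.card : ℝ) ≠ 0 := by simpa using hR.ne_empty
    rw [Finset.sum_union hSR,
      Finset.sum_congr rfl (g := fun _ => (8 * K / S.card / 2) ^ 2) fun a ha => by simp [ha],
      Finset.sum_congr (s₁ := R) rfl (g := fun _ => (8 * K / R.card / 2) ^ 2) fun a ha => by
        simp [Finset.disjoint_right.1 hSR ha]]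
    simp only [Finset.sum_const, nsmul_eq_mul]
    field_simp
    ring

theorem integral_kernel_comp (hk : IsBoundedKernel k) {p q : α} (hpq : p ≠ q) :
    ∫ z, k (z p) (z q) ∂(Measure.infinitePi μ) = kernelMean k (μ p) (μ q) := by
  have hint : Integrable (fun z : α → ℝ => k (z p) (z q)) (Measure.infinitePi μ) :=
    integrable_of_abs_le (measurable_kernel_comp hk p q) fun z => hk.abs_le_kernelSup _ _
  have hm : Measurable fun x => ∫ y, k x y ∂(μ q) :=
    (StronglyMeasurable.integral_prod_right' (ν := μ q) hk.measurable.stronglyMeasurable).measurable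
  have hint' : Integrable (fun z : α → ℝ => ∫ y, k (z p) y ∂(μ q)) (Measure.infinitePi μ) :=
    integrable_of_abs_le (hm.comp (measurable_pi_apply p)) fun z =>
      abs_integral_le_of_abs_le fun y => hk.abs_le_kernelSup _ _
  rw [integral_infinitePi_eq_integral_update μ q hint]
  simp only [Function.update_self, Function.update_of_ne hpq]
  rw [integral_infinitePi_eq_integral_update μ p hint']
  simp [kernelMean]

/-- If the family indexed by `S` has law `Q₁`, and the one indexed by `R` is a mixture of `r - v`
observations of law `Q₁` and `v` observations of law `Q₂`, then the mean of the empirical squared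
MMD is the squared MMD between `Q₁` and `Q₂` times the proportion `v (v - 1) / (r (r - 1))` of
ordered pairs of distinct members of `R` of which both have law `Q₂`. -/
theorem integral_mmdStat (hk : IsBoundedKernel k) {Q₁ Q₂ : Measure ℝ} [IsProbabilityMeasure Q₁]
    [IsProbabilityMeasure Q₂] {S R : Finset α} (hSR : Disjoint S R) (hS : 2 ≤ S.card)
    (hR : 2 ≤ R.card) (U : α → Prop) [DecidablePred U] (hμS : ∀ a ∈ S, μ a = Q₁)
    (hμR : ∀ a ∈ R, μ a = if U a then Q₂ else Q₁) :
    ∫ z, mmdStat k S R z ∂(Measure.infinitePi μ)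
      = (kernelMean k Q₁ Q₁ - 2 * kernelMean k Q₁ Q₂ + kernelMean k Q₂ Q₂)
        * (((R.filter U).card : ℝ) * (((R.filter U).card : ℝ) - 1)
          / ((R.card : ℝ) * ((R.card : ℝ) - 1))) := by
  have hint : ∀ p q : α, Integrable (fun z : α → ℝ => k (z p) (z q)) (Measure.infinitePi μ) :=
    fun p q => integrable_of_abs_le (measurable_kernel_comp hk p q) fun z =>
      hk.abs_le_kernelSup _ _
  have hcomm := hk.kernelMean_comm Q₁ Q₂
  have hSoff : ∫ z, ∑ p ∈ S.offDiag, k (z p.1) (z p.2) ∂(Measure.infinitePi μ)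
      = S.card * ((S.card : ℝ) - 1) * kernelMean k Q₁ Q₁ := by
    rw [integral_finsetSum _ fun p _ => hint _ _,
      Finset.sum_congr rfl (g := fun _ => kernelMean k Q₁ Q₁) fun p hp => by
        rw [Finset.mem_offDiag] at hp
        rw [integral_kernel_comp μ hk hp.2.2, hμS _ hp.1, hμS _ hp.2.1]]
    have := sum_offDiag_add_sum_diag S fun _ _ => kernelMean k Q₁ Q₁
    simp only [Finset.sum_const, nsmul_eq_mul] at this ⊢
    linarith
  -- `u` marks the members of `R` of law `Q₂`
  set u : α → ℝ := fun a => if U a then 1 else 0 with hu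
  have husum : ∑ a ∈ R, u a = (R.filter U).card := by simp [hu]
  have huu : ∀ a, u a * u a = u a := fun a => by by_cases h : U a <;> simp [hu, h]
  have hRoff : ∫ z, ∑ p ∈ R.offDiag, k (z p.1) (z p.2) ∂(Measure.infinitePi μ)
      = R.card * ((R.card : ℝ) - 1) * kernelMean k Q₁ Q₁
        + 2 * (R.filter U).card * ((R.card : ℝ) - 1) * (kernelMean k Q₁ Q₂ - kernelMean k Q₁ Q₁)
        + (R.filter U).card * (((R.filter U).card : ℝ) - 1)
          * (kernelMean k Q₁ Q₁ - 2 * kernelMean k Q₁ Q₂ + kernelMean k Q₂ Q₂) := by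
    set F : α → α → ℝ := fun a b => kernelMean k Q₁ Q₁
      + (u a + u b) * (kernelMean k Q₁ Q₂ - kernelMean k Q₁ Q₁)
      + u a * u b * (kernelMean k Q₁ Q₁ - 2 * kernelMean k Q₁ Q₂ + kernelMean k Q₂ Q₂) with hF
    rw [integral_finsetSum _ fun p _ => hint _ _,
      Finset.sum_congr rfl (g := fun p => F p.1 p.2) fun p hp => by
        rw [Finset.mem_offDiag] at hp
        rw [integral_kernel_comp μ hk hp.2.2, hμR _ hp.1, hμR _ hp.2.1]
        by_cases h1 : U p.1 <;> by_cases h2 : U p.2 <;> simp [hF, hu, h1, h2] <;> linarith]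
    have hsum := sum_offDiag_add_sum_diag R F
    have hd : ∑ x ∈ R, F x x = R.card * kernelMean k Q₁ Q₁
        + 2 * (R.filter U).card * (kernelMean k Q₁ Q₂ - kernelMean k Q₁ Q₁)
        + (R.filter U).card
          * (kernelMean k Q₁ Q₁ - 2 * kernelMean k Q₁ Q₂ + kernelMean k Q₂ Q₂) := by
      simp only [hF, huu, Finset.sum_add_distrib, ← Finset.sum_mul, husum, Finset.sum_const,
        nsmul_eq_mul]
      ring
    have hf : ∑ x ∈ R, ∑ y ∈ R, F x y = R.card * R.card * kernelMean k Q₁ Q₁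
        + 2 * (R.filter U).card * R.card * (kernelMean k Q₁ Q₂ - kernelMean k Q₁ Q₁)
        + (R.filter U).card * (R.filter U).card
          * (kernelMean k Q₁ Q₁ - 2 * kernelMean k Q₁ Q₂ + kernelMean k Q₂ Q₂) := by
      simp only [hF, Finset.sum_add_distrib, ← Finset.sum_mul, ← Finset.mul_sum, husum,
        Finset.sum_const, nsmul_eq_mul]
      ring
    linarith
  have hcross : ∫ z, ∑ a ∈ S, ∑ b ∈ R, k (z a) (z b) ∂(Measure.infinitePi μ)
      = S.card * (R.card * kernelMean k Q₁ Q₁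
          + (R.filter U).card * (kernelMean k Q₁ Q₂ - kernelMean k Q₁ Q₁)) := by
    rw [integral_finsetSum _ fun a _ => integrable_finsetSum _ fun b _ => hint _ _,
      Finset.sum_congr rfl (g := fun _ => (R.card * kernelMean k Q₁ Q₁
          + (R.filter U).card * (kernelMean k Q₁ Q₂ - kernelMean k Q₁ Q₁))) fun a ha => ?_]
    · simp only [Finset.sum_const, nsmul_eq_mul]
    · rw [integral_finsetSum _ fun b _ => hint _ _,
        Finset.sum_congr rfl (g := fun b => kernelMean k Q₁ Q₁
          + u b * (kernelMean k Q₁ Q₂ - kernelMean k Q₁ Q₁)) fun b hb => ?_]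
      · rw [Finset.sum_add_distrib, ← Finset.sum_mul, husum]; simp
      · have hab : a ≠ b := fun h => Finset.disjoint_left.1 hSR ha (h ▸ hb)
        rw [integral_kernel_comp μ hk hab, hμS _ ha, hμR _ hb]
        by_cases h : U b <;> simp [hu, h]
  have hi : ∀ W : Finset (α × α), Integrable (fun z : α → ℝ => ∑ p ∈ W, k (z p.1) (z p.2))
      (Measure.infinitePi μ) := fun W => integrable_finsetSum _ fun p _ => hint _ _
  have hic : Integrable (fun z : α → ℝ => ∑ a ∈ S, ∑ b ∈ R, k (z a) (z b))
      (Measure.infinitePi μ) :=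
    integrable_finsetSum _ fun a _ => integrable_finsetSum _ fun b _ => hint _ _
  unfold mmdStat
  rw [integral_sub (f := fun z : α → ℝ => _ * _ + _ * _)
      (((hi _).const_mul _).add ((hi _).const_mul _)) (hic.const_mul _),
    integral_add ((hi _).const_mul _) ((hi _).const_mul _), integral_const_mul,
    integral_const_mul, integral_const_mul, hSoff, hRoff, hcross]
  have h1 : (2 : ℝ) ≤ S.card := by exact_mod_cast hS
  have h2 : (2 : ℝ) ≤ R.card := by exact_mod_cast hR
  have h3 : (S.card : ℝ) - 1 ≠ 0 := by linarith
  have h4 : (R.card : ℝ) - 1 ≠ 0 := by linarith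
  have h5 : (S.card : ℝ) ≠ 0 := by linarith
  have h6 : (R.card : ℝ) ≠ 0 := by linarith
  field_simp
  ring

end Statistic

/-! ### Exponentially small events -/

section ExpSmall

variable {Ω : Type*} [MeasurableSpace Ω] {P : Measure Ω} {E F : ℕ → Set Ω} {g g' : ℝ}

/-- The probability of `E n` decays exponentially with rate at least `g`, up to subexponential
factors. -/
def ExpSmall (P : Measure Ω) (E : ℕ → Set Ω) (g : ℝ) : Prop :=
  ∀ g' < g, ∀ᶠ n : ℕ in atTop, P (E n) ≤ ENNReal.ofReal (Real.exp (-(g' * n)))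

theorem ExpSmall.mono (h : ExpSmall P E g) (hEF : ∀ n, F n ⊆ E n) (hg : g' ≤ g) :
    ExpSmall P F g' := fun r hr => by
  filter_upwards [h r (hr.trans_le hg)] with n hn
  exact (measure_mono (hEF n)).trans hn

/-- A constant factor is absorbed by an arbitrarily small loss in the rate. -/
theorem eventually_mul_exp_le (C : ℝ) (h : g' < g) :
    ∀ᶠ n : ℕ in atTop, C * Real.exp (-(g * n)) ≤ Real.exp (-(g' * n)) := by
  have : Tendsto (fun n : ℕ => Real.exp ((g - g') * n)) atTop atTop :=
    Real.tendsto_exp_atTop.comp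
      (tendsto_natCast_atTop_atTop.const_mul_atTop (sub_pos.2 h))
  filter_upwards [this.eventually_ge_atTop C] with n hn
  calc C * Real.exp (-(g * n)) ≤ Real.exp ((g - g') * n) * Real.exp (-(g * n)) := by gcongr
    _ = Real.exp (-(g' * n)) := by rw [← Real.exp_add]; ring_nf

theorem ExpSmall.biUnion {β : Type*} (s : Finset β) {E : β → ℕ → Set Ω}
    (h : ∀ b ∈ s, ExpSmall P (E b) g) : ExpSmall P (fun n => ⋃ b ∈ s, E b n) g := fun r hr => by
  obtain ⟨r', hr', hr'g⟩ := exists_between hr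
  have hall : ∀ᶠ n : ℕ in atTop, ∀ b ∈ s, P (E b n) ≤ ENNReal.ofReal (Real.exp (-(r' * n))) :=
    (eventually_all_finset s).2 fun b hb => h b hb r' hr'g
  filter_upwards [hall, eventually_mul_exp_le s.card hr'] with n hn hn'
  calc P (⋃ b ∈ s, E b n) ≤ ∑ b ∈ s, P (E b n) := measure_biUnion_finset_le _ _
    _ ≤ ∑ _b ∈ s, ENNReal.ofReal (Real.exp (-(r' * n))) := Finset.sum_le_sum hn
    _ = ENNReal.ofReal (s.card * Real.exp (-(r' * n))) := by
        rw [Finset.sum_const, nsmul_eq_mul, ENNReal.ofReal_mul (Nat.cast_nonneg _),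
          ENNReal.ofReal_natCast]
    _ ≤ _ := ENNReal.ofReal_le_ofReal hn'

theorem ExpSmall.union (hE : ExpSmall P E g) (hF : ExpSmall P F g) :
    ExpSmall P (fun n => E n ∪ F n) g := by
  refine (ExpSmall.biUnion (Finset.univ : Finset Bool) (E := fun b => cond b E F)
    fun b _ => ?_).mono (fun n => ?_) le_rfl
  · cases b
    exacts [hF, hE]
  · intro y hy
    simpa [or_comm] using hy

/-- The tail of the series of probabilities from time `N - 1` on is geometric, so it decays at the
same rate in `N`. -/
theorem ExpSmall.tsum_le (h : ExpSmall P E g) (hg : 0 < g) (hg' : g' < g) :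
    ∀ᶠ N : ℕ in atTop,
      ∑' m : ℕ, P (E (N - 1 + m)) ≤ ENNReal.ofReal (Real.exp (-(g' * N))) := by
  obtain ⟨r, hr, hrg⟩ := exists_between (max_lt hg hg')
  have hr0 : 0 < r := (le_max_left _ _).trans_lt hr
  have hq : Real.exp (-r) < 1 := by simpa using hr0
  obtain ⟨N₀, hN₀⟩ := eventually_atTop.1 (h r hrg)
  filter_upwards [eventually_mul_exp_le (Real.exp r * (1 - Real.exp (-r))⁻¹)
    ((le_max_right _ _).trans_lt hr), eventually_ge_atTop (N₀ + 1)] with N hN hNN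
  have hN1 : ((N - 1 : ℕ) : ℝ) = N - 1 := by rw [Nat.cast_sub (by omega), Nat.cast_one]
  calc ∑' m : ℕ, P (E (N - 1 + m))
      ≤ ∑' m : ℕ, ENNReal.ofReal (Real.exp r * Real.exp (-(r * N)) * Real.exp (-r) ^ m) := by
        refine ENNReal.tsum_le_tsum fun m => (hN₀ (N - 1 + m) (by omega)).trans (le_of_eq ?_)
        rw [← Real.exp_nat_mul, ← Real.exp_add, ← Real.exp_add]
        congr 2
        push_cast
        rw [hN1]
        ring
    _ = ENNReal.ofReal (Real.exp r * Real.exp (-(r * N)) * (1 - Real.exp (-r))⁻¹) := by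
        rw [← tsum_geometric_of_lt_one (Real.exp_pos _).le hq, ← tsum_mul_left,
          ENNReal.ofReal_tsum_of_nonneg (fun m => by positivity)
            ((summable_geometric_of_lt_one (Real.exp_pos _).le hq).mul_left _)]
    _ ≤ _ := ENNReal.ofReal_le_ofReal (by linarith)

/-- As `e N ≤ N`, it suffices to compare `-log (p N)` with `N`. For a nonpositive exponent nothing is
needed beyond `p N ≤ 1`. -/
theorem le_exponent {p e : ℕ → ℝ≥0∞} (hg : ∀ r, 0 < r → r < g →
      ∀ᶠ N : ℕ in atTop, p N ≤ ENNReal.ofReal (Real.exp (-(r * N))))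
    (hp : ∀ N, p N ≤ 1) (he0 : ∀ N, e N ≠ 0) (he : ∀ᶠ N : ℕ in atTop, e N ≤ N) :
    (g : EReal) ≤ exponent p e := by
  refine le_of_forall_lt fun c hc => ?_
  obtain ⟨r, hcr, hrg⟩ := EReal.lt_iff_exists_real_btwn.1 hc
  rw [EReal.coe_lt_coe_iff] at hrg
  refine hcr.trans_le (le_liminf_of_le (by isBoundedDefault) ?_)
  rcases le_or_gt r 0 with hr | hr
  · refine Eventually.of_forall fun N => (EReal.coe_le_coe_iff.2 hr).trans ?_
    refine EReal.div_nonneg ?_ (EReal.coe_ennreal_nonneg _)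
    rw [EReal.neg_nonneg]
    exact ENNReal.log_le_zero_iff.2 (hp N)
  · filter_upwards [hg r hr hrg, he] with N hpN heN
    have hlog : ((r * N : ℝ) : EReal) ≤ -ENNReal.log (p N) := by
      rw [EReal.le_neg, ← EReal.coe_neg]
      refine (ENNReal.log_le_log hpN).trans (le_of_eq ?_)
      rw [ENNReal.log_ofReal_of_pos (Real.exp_pos _), Real.log_exp]
    rw [EReal.le_div_iff_mul_le (EReal.coe_ennreal_pos.2 (pos_iff_ne_zero.2 (he0 N)))
      (by simpa using ne_top_of_le_ne_top (ENNReal.natCast_ne_top N) heN)]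
    refine le_trans ?_ hlog
    rw [EReal.coe_mul]
    refine mul_le_mul_of_nonneg_left ?_ (EReal.coe_nonneg.2 hr.le)
    exact EReal.coe_ennreal_le_coe_ennreal_iff.2 heN

end ExpSmall

/-! ### Stopping and decisions -/

section Test

variable {M : ℕ} {k : ℝ → ℝ → ℝ} {tie : Finset (Finset (Fin M)) → Finset (Fin M)}
  {lam1 lam2 : ℝ} {fN fA : ℝ → ℝ} {B : Finset (Fin M)} {E : ℕ → Set (Path M)} {g : ℝ}

theorem IsPDF.isProbabilityMeasure_law {f : ℝ → ℝ} (hf : IsPDF f) :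
    IsProbabilityMeasure (law f) :=
  ⟨by rw [law, withDensity_apply _ MeasurableSet.univ, Measure.restrict_univ,
    hf.lintegral_eq_one]⟩

instance isProbabilityMeasure_coordinateLaw [IsProbabilityMeasure (law fN)]
    [IsProbabilityMeasure (law fA)] (a : Fin M × ℕ) :
    IsProbabilityMeasure (if a.1 ∈ B then law fA else law fN) := by
  split_ifs <;> infer_instance

instance isProbabilityMeasure_hypLaw [IsProbabilityMeasure (law fN)]
    [IsProbabilityMeasure (law fA)] : IsProbabilityMeasure (hypLaw fN fA B) := by
  unfold hypLaw; infer_instance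

/-- The condition that makes the test stop after `n` observations, if it is still running. -/
def StopsAt (k : ℝ → ℝ → ℝ) (tie : Finset (Finset (Fin M)) → Finset (Fin M))
    (lam1 lam2 : ℝ) (n : ℕ) (y : Path M) : Prop :=
  (∃ t ∈ Finset.Icc 1 (maxOutliers M), Selects k tie lam1 lam2 n y t) ∨
    ∀ t ∈ Finset.Icc 1 (maxOutliers M), secondScore k tie n y t < lam2

theorem stopTime_le {N n : ℕ} {y : Path M} (h1 : 1 ≤ n) (hN : N ≤ n + 1)
    (h : StopsAt k tie lam1 lam2 n y) : stopTime k tie lam1 lam2 N y ≤ n :=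
  sInf_le ⟨n, ⟨h1, hN, h⟩, rfl⟩

theorem one_le_stopTime (N : ℕ) (y : Path M) : 1 ≤ stopTime k tie lam1 lam2 N y := by
  refine le_sInf ?_
  rintro _ ⟨n, ⟨h1, -⟩, rfl⟩
  exact Nat.one_le_cast.2 h1

theorem stopsAt_of_stopTime_eq {N n : ℕ} {y : Path M}
    (h : stopTime k tie lam1 lam2 N y = n) : N ≤ n + 1 ∧ StopsAt k tie lam1 lam2 n y := by
  have hne : ((fun n : ℕ => (n : ℕ∞)) '' {n : ℕ | 1 ≤ n ∧ N ≤ n + 1 ∧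
      StopsAt k tie lam1 lam2 n y}).Nonempty := by
    by_contra hemp
    rw [Set.not_nonempty_iff_eq_empty] at hemp
    have : stopTime k tie lam1 lam2 N y = ⊤ := by
      unfold stopTime
      unfold StopsAt at hemp
      rw [hemp, sInf_empty]
    rw [this] at h
    exact ENat.top_ne_natCast n h
  obtain ⟨m, hm, hmn⟩ := csInf_mem hne
  have : (m : ℕ∞) = n := hmn.trans h
  rw [Nat.cast_inj] at this
  subst this
  exact hm.2

theorem stopTime_le_add_tsum_indicator {N : ℕ} (hN : 2 ≤ N) (y : Path M)
    (hE : ∀ n, y ∉ E n → StopsAt k tie lam1 lam2 n y) :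
    (stopTime k tie lam1 lam2 N y : ℝ≥0∞)
      ≤ ((N - 1 : ℕ) : ℝ≥0∞) + ∑' m : ℕ, (E (N - 1 + m)).indicator 1 y := by
  classical
  by_cases hex : ∃ m, y ∉ E (N - 1 + m)
  · have hfind := Nat.find_spec hex
    set m := Nat.find hex
    have hle : stopTime k tie lam1 lam2 N y ≤ ((N - 1 + m : ℕ) : ℕ∞) :=
      stopTime_le (by omega) (by omega) (hE _ hfind)
    have hsum : (m : ℝ≥0∞) ≤ ∑' m : ℕ, (E (N - 1 + m)).indicator (1 : Path M → ℝ≥0∞) y := by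
      refine le_trans (le_of_eq ?_) (ENNReal.sum_le_tsum (Finset.range m))
      rw [Finset.sum_congr rfl (g := fun _ => (1 : ℝ≥0∞)) fun i hi => ?_]
      · simp
      · have : y ∈ E (N - 1 + i) := not_not.1 (Nat.find_min hex (Finset.mem_range.1 hi))
        simp [this]
    calc (stopTime k tie lam1 lam2 N y : ℝ≥0∞) ≤ (((N - 1 + m : ℕ) : ℕ∞) : ℝ≥0∞) :=
          ENat.toENNReal_le.2 hle
      _ = ((N - 1 : ℕ) : ℝ≥0∞) + m := by push_cast; rfl
      _ ≤ _ := by gcongr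
  · push Not at hex
    have : ∑' m : ℕ, (E (N - 1 + m)).indicator (1 : Path M → ℝ≥0∞) y = ⊤ := by
      simp only [Set.indicator_of_mem (hex _), Pi.one_apply]
      exact ENNReal.tsum_const_eq_top_of_ne_zero one_ne_zero
    rw [this, add_top]
    exact le_top

/-- If the test stops at `n` off an exponentially small event, then the expected delay beyond
`N - 1` is a geometric tail, which is at most one for large `N`. -/
theorem expStop_le_of_expSmall (hsmall : ExpSmall (hypLaw fN fA B) E g) (hg : 0 < g)
    [IsProbabilityMeasure (law fN)] [IsProbabilityMeasure (law fA)]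
    (hE : ∀ n y, y ∉ E n → StopsAt k tie lam1 lam2 n y) :
    ∀ᶠ N : ℕ in atTop, expStop k tie lam1 lam2 fN fA B N ≤ N := by
  filter_upwards [hsmall.tsum_le hg hg, eventually_ge_atTop 2] with N hN hN2
  set P := hypLaw fN fA B
  set E' : ℕ → Set (Path M) := fun n => toMeasurable P (E n)
  have hE' : ∀ n, MeasurableSet (E' n) := fun n => measurableSet_toMeasurable _ _
  calc expStop k tie lam1 lam2 fN fA B N
      ≤ ∫⁻ y, (((N - 1 : ℕ) : ℝ≥0∞) + ∑' m : ℕ, (E' (N - 1 + m)).indicator 1 y) ∂P :=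
        lintegral_mono fun y => stopTime_le_add_tsum_indicator hN2 y fun n hn =>
          hE n y fun h => hn (subset_toMeasurable _ _ h)
    _ = ((N - 1 : ℕ) : ℝ≥0∞) + ∑' m : ℕ, P (E (N - 1 + m)) := by
        rw [lintegral_add_left measurable_const, lintegral_tsum fun m =>
          (measurable_one.indicator (hE' _)).aemeasurable]
        simp [hE', E']
    _ ≤ ((N - 1 : ℕ) : ℝ≥0∞) + 1 := by
        gcongr
        refine hN.trans (ENNReal.ofReal_le_one.2 (Real.exp_le_one_iff.2 ?_))
        have : 0 ≤ g * N := by positivity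
        linarith
    _ = N := by
        exact_mod_cast congrArg (Nat.cast (R := ℝ≥0∞)) (Nat.sub_add_cancel (by omega : 1 ≤ N))

theorem expStop_ne_zero [IsProbabilityMeasure (law fN)] [IsProbabilityMeasure (law fA)] (N : ℕ) :
    expStop k tie lam1 lam2 fN fA B N ≠ 0 := by
  refine (zero_lt_one.trans_le ?_).ne'
  calc (1 : ℝ≥0∞) = ∫⁻ _y, 1 ∂(hypLaw fN fA B) := by simp
    _ ≤ _ := lintegral_mono fun y => by
      have := ENat.toENNReal_le.2 (one_le_stopTime (k := k) (tie := tie) (lam1 := lam1)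
        (lam2 := lam2) N y)
      simpa using this

/-- If stopping at `n` with a decision in `A` entails an event of exponential rate `g`, then the
probability of deciding in `A` has exponent at least `g`. -/
theorem le_exponent_probDecide [IsProbabilityMeasure (law fN)] [IsProbabilityMeasure (law fA)]
    {A : Set (Option (Finset (Fin M)))} (hsmall : 0 < g → ExpSmall (hypLaw fN fA B) E g)
    (hA : ∀ n y, StopsAt k tie lam1 lam2 n y → decision k tie lam1 lam2 n y ∈ A → y ∈ E n)
    (he : ∀ᶠ N : ℕ in atTop, expStop k tie lam1 lam2 fN fA B N ≤ N) :
    (g : EReal) ≤ exponent (probDecide k tie lam1 lam2 fN fA B A)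
      (expStop k tie lam1 lam2 fN fA B) := by
  refine le_exponent (fun r hr hrg => ?_) (fun N => prob_le_one) expStop_ne_zero he
  filter_upwards [(hsmall (hr.trans hrg)).tsum_le (hr.trans hrg) hrg] with N hN
  refine (measure_mono ?_).trans ((measure_iUnion_le _).trans hN)
  rintro y ⟨n, hn, hd⟩
  obtain ⟨hNn, hs⟩ := stopsAt_of_stopTime_eq hn
  refine Set.mem_iUnion.2 ⟨n - (N - 1), ?_⟩
  rw [show N - 1 + (n - (N - 1)) = n by omega]
  exact hA n y hs hd

end Test

/-! ### Concentration of the block statistics -/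

section Concentration

/-- Statistics with sub-Gaussian fluctuations of variance proxy `v / n`, whose means are
asymptotically at most `m₀`, exceed `ε > m₀` with exponential rate `(ε - m₀)² / (2 v)`. -/
theorem expSmall_of_hasSubgaussianMGF {Ω : Type*} [MeasurableSpace Ω] {P : Measure Ω}
    [IsFiniteMeasure P] {X : ℕ → Ω → ℝ} {m : ℕ → ℝ} {v m₀ ε : ℝ} (hv : 0 < v)
    (hX : ∀ᶠ n : ℕ in atTop,
      ProbabilityTheory.HasSubgaussianMGF (fun y => X n y - m n) (v / n).toNNReal P)
    (hm : ∀ m' > m₀, ∀ᶠ n : ℕ in atTop, m n ≤ m') (hε : m₀ < ε) :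
    ExpSmall P (fun n => {y | ε ≤ X n y}) ((ε - m₀) ^ 2 / (2 * v)) := by
  intro g' hg'
  have hcont : Tendsto (fun m' : ℝ => (ε - m') ^ 2 / (2 * v)) (nhdsWithin m₀ (Set.Ioi m₀))
      (nhds ((ε - m₀) ^ 2 / (2 * v))) :=
    (Continuous.tendsto (by fun_prop) m₀).mono_left nhdsWithin_le_nhds
  obtain ⟨m', hgm, hm₀, hmε⟩ := ((hcont.eventually_const_lt hg').and
    (Ioo_mem_nhdsGT hε)).exists
  filter_upwards [hX, hm m' hm₀, eventually_gt_atTop 0] with n hXn hmn hn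
  have hn' : (0 : ℝ) < n := by exact_mod_cast hn
  rw [← ofReal_measureReal]
  refine ENNReal.ofReal_le_ofReal ?_
  calc P.real {y | ε ≤ X n y} ≤ P.real {y | ε - m' ≤ X n y - m n} :=
        measureReal_mono fun y (hy : ε ≤ X n y) => by
          simp only [Set.mem_ofPred_eq]; linarith
    _ ≤ Real.exp (-(ε - m') ^ 2 / (2 * ((v / n).toNNReal : ℝ))) :=
        hXn.measure_ge_le (by linarith)
    _ ≤ _ := by
        rw [Real.coe_toNNReal _ (by positivity)]
        refine Real.exp_le_exp.2 ?_
        have : -(ε - m') ^ 2 / (2 * (v / n)) = -((ε - m') ^ 2 / (2 * v) * n) := by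
          field_simp
        rw [this]
        exact neg_le_neg (mul_le_mul_of_nonneg_right hgm.le hn'.le)

variable {M : ℕ} {k : ℝ → ℝ → ℝ} {fN fA : ℝ → ℝ} {B D : Finset (Fin M)} {j : Fin M} {K : ℝ}

/-- The statistic that compares the `j`-th sequence with the union of the other sequences outside
`D`. -/
noncomputable def blockStat (k : ℝ → ℝ → ℝ) (D : Finset (Fin M)) (j : Fin M) (n : ℕ) (y : Path M) :
    ℝ :=
  mmdStat k (block {j} n) (block (Dᶜ.erase j) n) y

theorem card_block (D : Finset (Fin M)) (n : ℕ) : (block D n).card = D.card * n := by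
  simp [block]

theorem disjoint_block_erase (D : Finset (Fin M)) (j : Fin M) (n : ℕ) :
    Disjoint (block {j} n) (block (D.erase j) n) :=
  Finset.disjoint_product.2 (Or.inl (by simp))

theorem filter_block (D : Finset (Fin M)) (n : ℕ) (p : Fin M → Prop) [DecidablePred p] :
    (block D n).filter (fun a => p a.1) = block (D.filter p) n := by
  ext a; simp [block, and_comm, and_left_comm]

theorem card_compl_erase (hj : j ∉ D) : (Dᶜ.erase j).card = M - D.card - 1 := by
  rw [Finset.card_erase_of_mem (by simpa using hj), Finset.card_compl, Fintype.card_fin]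

variable [IsProbabilityMeasure (law fN)] [IsProbabilityMeasure (law fA)]

theorem hasSubgaussianMGF_blockStat (hk : IsBoundedKernel k) (hK : ∀ x y, |k x y| ≤ K)
    {r : ℕ} (hr : (Dᶜ.erase j).card = r) (hr0 : 0 < r) {n : ℕ} (hn : 0 < n) :
    ProbabilityTheory.HasSubgaussianMGF
      (fun y => blockStat k D j n y - ∫ y, blockStat k D j n y ∂(hypLaw fN fA B))
      (16 * K ^ 2 * (1 + 1 / (r : ℝ)) / n).toNNReal (hypLaw fN fA B) := by
  have hS : (block {j} n).card = n := by simp [card_block]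
  have hR : (block (Dᶜ.erase j) n).card = r * n := by rw [card_block, hr]
  have h := hasSubgaussianMGF_mmdStat
    (fun a : Fin M × ℕ => if a.1 ∈ B then law fA else law fN) hk hK
    (disjoint_block_erase Dᶜ j n) (Finset.card_pos.1 (by rw [hS]; exact hn))
    (Finset.card_pos.1 (by rw [hR]; positivity))
  rw [hS, hR] at h
  have e : 16 * K ^ 2 * (1 + 1 / (r : ℝ)) / n
      = 16 * K ^ 2 * (1 / (n : ℝ) + 1 / ((r * n : ℕ) : ℝ)) := by
    have : (n : ℝ) ≠ 0 := by positivity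
    have : (r : ℝ) ≠ 0 := by positivity
    push_cast
    field_simp
  rw [e]
  exact h

theorem integral_blockStat_of_notMem (hk : IsBoundedKernel k) (hj : j ∉ B) {r : ℕ}
    (hr : (Dᶜ.erase j).card = r) (hr0 : 0 < r) (hBD : B ⊆ D) {n : ℕ} (hn : 2 ≤ n) :
    ∫ y, blockStat k D j n y ∂(hypLaw fN fA B) = 0 := by
  have hR : (block (Dᶜ.erase j) n).card = r * n := by rw [card_block, hr]
  have h := integral_mmdStat (fun a : Fin M × ℕ => if a.1 ∈ B then law fA else law fN) hk
    (Q₁ := law fN) (Q₂ := law fA) (disjoint_block_erase Dᶜ j n) (by simpa [card_block] using hn)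
    (by rw [hR]; nlinarith) (fun a => a.1 ∈ B)
    (fun a ha => by
      have : a.1 = j := by simpa [block] using (Finset.mem_product.1 ha).1
      simp [this, hj])
    (fun a _ => rfl)
  have hempty : (block (Dᶜ.erase j) n).filter (fun a => a.1 ∈ B) = ∅ := by
    rw [filter_block _ _ fun i => i ∈ B, Finset.filter_eq_empty_iff.2 fun i hi hiB => ?_]
    · simp [block]
    · simp only [Finset.mem_erase, Finset.mem_compl] at hi
      exact hi.2 (hBD hiB)
  rw [hempty] at h
  exact h.trans (by simp)

theorem integral_blockStat_of_mem (hk : IsBoundedKernel k) (hj : j ∈ B) {r v : ℕ}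
    (hr : (Dᶜ.erase j).card = r) (hr0 : 0 < r) (hv : ((Dᶜ.erase j).filter (· ∉ B)).card = v)
    {n : ℕ} (hn : 2 ≤ n) :
    ∫ y, blockStat k D j n y ∂(hypLaw fN fA B)
      = mmdSq k fN fA * ((v * n : ℝ) * (v * n - 1) / ((r * n) * (r * n - 1))) := by
  have hR : (block (Dᶜ.erase j) n).card = r * n := by rw [card_block, hr]
  have h := integral_mmdStat (fun a : Fin M × ℕ => if a.1 ∈ B then law fA else law fN) hk
    (Q₁ := law fA) (Q₂ := law fN) (disjoint_block_erase Dᶜ j n) (by simpa [card_block] using hn)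
    (by rw [hR]; nlinarith) (fun a => a.1 ∉ B)
    (fun a ha => by
      have : a.1 = j := by simpa [block] using (Finset.mem_product.1 ha).1
      simp [this, hj])
    (fun a _ => by by_cases ha : a.1 ∈ B <;> simp [ha])
  rw [filter_block _ _ fun i => i ∉ B, card_block, hv, hR] at h
  rw [hk.mmdSq_comm fN fA]
  push_cast at h
  exact h

theorem tendsto_pair_proportion (v : ℝ) {r : ℝ} (hr : r ≠ 0) :
    Tendsto (fun n : ℕ => (v * n) * (v * n - 1) / ((r * n) * (r * n - 1))) atTop
      (nhds ((v / r) ^ 2)) := by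
  have hinv : Tendsto (fun n : ℕ => 1 / (n : ℝ)) atTop (nhds 0) :=
    tendsto_const_div_atTop_nhds_zero_nat 1
  have h : Tendsto (fun n : ℕ => v / r * ((v - 1 / (n : ℝ)) / (r - 1 / (n : ℝ)))) atTop
      (nhds (v / r * ((v - 0) / (r - 0)))) :=
    ((hinv.const_sub v).div (hinv.const_sub r) (by simpa using hr)).const_mul _
  rw [sub_zero, sub_zero, ← sq] at h
  refine h.congr' ?_
  filter_upwards [eventually_gt_atTop 0] with n hn
  have hn' : (n : ℝ) ≠ 0 := by positivity
  rw [← mul_div_mul_right (v - 1 / (n : ℝ)) (r - 1 / (n : ℝ)) hn', sub_mul, sub_mul,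
    one_div_mul_cancel hn', div_mul_div_comm, ← mul_div_mul_right (v * _) (r * _) hn']
  congr 1 <;> ring

/-- If all sequences outside `D` are nominal, then large values of the statistics outside `D` are
exponentially unlikely. -/
theorem expSmall_le_blockStat (hk : IsBoundedKernel k) (hK : ∀ x y, |k x y| ≤ K) (hK0 : 0 < K)
    (hBD : B ⊆ D) (hj : j ∉ D) {r : ℕ} (hr : (Dᶜ.erase j).card = r) (hr0 : 0 < r) {lam : ℝ}
    (hlam : 0 < lam) :
    ExpSmall (hypLaw fN fA B) (fun n => {y | lam ≤ blockStat k D j n y})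
      (lam ^ 2 / (32 * K ^ 2 * (1 + 1 / (r : ℝ)))) := by
  have h := expSmall_of_hasSubgaussianMGF (P := hypLaw fN fA B) (X := blockStat k D j) (m₀ := 0)
    (v := 16 * K ^ 2 * (1 + 1 / (r : ℝ))) (by positivity)
    ((eventually_gt_atTop 0).mono fun n hn => hasSubgaussianMGF_blockStat hk hK hr hr0 hn)
    (fun m' hm' => (eventually_ge_atTop 2).mono fun n hn => by
      rw [integral_blockStat_of_notMem hk (fun hjB => hj (hBD hjB)) hr hr0 hBD hn]
      exact hm'.le) hlam
  refine h.mono (fun n => subset_rfl) (le_of_eq ?_)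
  rw [sub_zero]
  ring_nf

/-- If the `j`-th sequence is an outlier and few of the other sequences outside `D` are, then
small values of its statistic are exponentially unlikely. -/
theorem expSmall_blockStat_le (hk : IsBoundedKernel k) (hK : ∀ x y, |k x y| ≤ K) (hK0 : 0 < K)
    (hj : j ∈ B) {r v : ℕ} (hr : (Dᶜ.erase j).card = r) (hr0 : 0 < r)
    (hv : ((Dᶜ.erase j).filter (· ∉ B)).card = v) {lam L : ℝ} (hlam : lam < L)
    (hL : L ≤ mmdSq k fN fA * (v / r : ℝ) ^ 2) :
    ExpSmall (hypLaw fN fA B) (fun n => {y | blockStat k D j n y ≤ lam})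
      ((L - lam) ^ 2 / (32 * K ^ 2 * (1 + 1 / (r : ℝ)))) := by
  have hlim : Tendsto (fun n => -∫ y, blockStat k D j n y ∂(hypLaw fN fA B)) atTop
      (nhds (-(mmdSq k fN fA * (v / r : ℝ) ^ 2))) := by
    refine ((tendsto_pair_proportion (v : ℝ) (r := r) (by positivity)).const_mul
      (mmdSq k fN fA)).neg.congr' ?_
    filter_upwards [eventually_ge_atTop 2] with n hn
    rw [integral_blockStat_of_mem hk hj hr hr0 hv hn]
  have h := expSmall_of_hasSubgaussianMGF (P := hypLaw fN fA B)
    (X := fun n y => -blockStat k D j n y) (m₀ := -L) (ε := -lam)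
    (v := 16 * K ^ 2 * (1 + 1 / (r : ℝ))) (by positivity)
    ((eventually_gt_atTop 0).mono fun n hn => by
      have := (hasSubgaussianMGF_blockStat (fN := fN) (fA := fA) (B := B) (D := D) (j := j)
        hk hK hr hr0 hn).neg
      convert this using 1
      ext y
      simp only [Pi.neg_apply]
      ring_nf)
    (fun m' hm' => (hlim.eventually_le_const (by linarith)))
    (by linarith)
  refine h.mono (fun n y hy => by simpa using hy) (le_of_eq ?_)
  ring_nf

end Concentration

/-! ### Scores and decisions in terms of the block statistics -/

section Scores

variable {M : ℕ} {k : ℝ → ℝ → ℝ} {tie : Finset (Finset (Fin M)) → Finset (Fin M)}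
  {lam lam1 lam2 : ℝ} {B D : Finset (Fin M)} {n t : ℕ} {y : Path M}

theorem two_mul_maxOutliers_lt (h : 1 ≤ maxOutliers M) : 2 * maxOutliers M + 1 ≤ M := by
  have h1 : (⌈(M : ℝ) / 2⌉₊ : ℝ) < M / 2 + 1 := Nat.ceil_lt_add_one (by positivity)
  have h2 : maxOutliers M + 1 = ⌈(M : ℝ) / 2⌉₊ := by unfold maxOutliers at *; omega
  rw [← h2] at h1
  push_cast at h1
  have h3 : ((2 * maxOutliers M : ℕ) : ℝ) < (M : ℕ) := by push_cast; linarith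
  exact_mod_cast h3

theorem mem_subsetsOfSize : D ∈ subsetsOfSize M t ↔ D.card = t := by
  simp [subsetsOfSize, Finset.mem_powersetCard]

theorem blockStat_le_score {j : Fin M} (hj : j ∉ D) : blockStat k D j n y ≤ score k n y D :=
  le_ciSup (f := fun j : {j : Fin M // j ∉ D} => blockStat k D j.1 n y)
    (Set.finite_range _).bddAbove ⟨j, hj⟩

theorem exists_le_blockStat (hD : D.card < M) (h : lam ≤ score k n y D) :
    ∃ j ∉ D, lam ≤ blockStat k D j n y := by
  obtain ⟨i, hi⟩ : ∃ i, i ∉ D := by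
    by_contra! hall
    rw [Finset.eq_univ_of_forall hall, Finset.card_univ, Fintype.card_fin] at hD
    exact hD.ne rfl
  have : Nonempty {j : Fin M // j ∉ D} := ⟨⟨i, hi⟩⟩
  obtain ⟨j, hj⟩ := exists_eq_ciSup_of_finite
    (f := fun j : {j : Fin M // j ∉ D} => blockStat k D j.1 n y)
  exact ⟨j.1, j.2, h.trans (le_of_eq hj.symm)⟩

theorem argminScore_mem_minimizers (htie : IsTieBreak tie) (ht : t ≤ M) :
    argminScore k tie n y t ∈ minimizers k n y t := by
  refine htie _ ?_
  have hne : (subsetsOfSize M t).Nonempty :=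
    Finset.powersetCard_nonempty.2 (by simpa using ht)
  obtain ⟨D, hD, hmin⟩ := (subsetsOfSize M t).exists_min_image (score k n y) hne
  exact ⟨D, by simp only [minimizers, Finset.mem_filter]; exact ⟨hD, hmin⟩⟩

theorem argminScore_score_le (htie : IsTieBreak tie) (hD : D.card = t) :
    score k n y (argminScore k tie n y t) ≤ score k n y D := by
  have ht : t ≤ M := hD ▸ (Finset.card_le_univ D).trans (by simp)
  have h := argminScore_mem_minimizers (k := k) (n := n) (y := y) htie ht
  simp only [minimizers, Finset.mem_filter] at h
  exact h.2 D (mem_subsetsOfSize.2 hD)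

theorem secondScore_le_score (hD : D.card = t) (hne : D ≠ argminScore k tie n y t) :
    secondScore k tie n y t ≤ score k n y D :=
  ciInf_le (f := fun D : {D : Finset (Fin M) // D ∈ subsetsOfSize M t
    ∧ D ≠ argminScore k tie n y t} => score k n y D.1) (Set.finite_range _).bddBelow
    ⟨D, mem_subsetsOfSize.2 hD, hne⟩

/-- A set with fewer than `t < M` elements has more than one superset of size `t`. -/
theorem exists_superset_card_eq_ne (hBt : B.card < t) (ht : t < M) (I : Finset (Fin M)) :
    ∃ D, B ⊆ D ∧ D.card = t ∧ D ≠ I := by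
  obtain ⟨D, hBD, hD⟩ := Finset.exists_superset_card_eq hBt.le (by simpa using ht.le)
  by_cases hDI : D = I
  · obtain ⟨x, hxD, hxB⟩ := Finset.exists_mem_notMem_of_card_lt_card (hD ▸ hBt)
    obtain ⟨z, hz⟩ : ∃ z, z ∉ D := by
      by_contra! hall
      rw [Finset.eq_univ_of_forall hall, Finset.card_univ, Fintype.card_fin] at hD
      exact ht.ne hD.symm
    have hzx : z ∉ D.erase x := fun h => hz (Finset.mem_of_mem_erase h)
    refine ⟨insert z (D.erase x), fun b hb => ?_, ?_, ?_⟩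
    · refine Finset.mem_insert_of_mem (Finset.mem_erase.2 ⟨?_, hBD hb⟩)
      rintro rfl
      exact hxB hb
    · have := Finset.card_pos.2 ⟨x, hxD⟩
      rw [Finset.card_insert_of_notMem hzx, Finset.card_erase_of_mem hxD]
      omega
    · rintro h
      exact hz (hDI ▸ h ▸ Finset.mem_insert_self z _)
  · exact ⟨D, hBD, hD, hDI⟩

theorem exists_score_eq_secondScore (ht0 : 0 < t) (ht : t < M) :
    ∃ D, D.card = t ∧ D ≠ argminScore k tie n y t
      ∧ score k n y D = secondScore k tie n y t := by
  obtain ⟨D, -, hD, hne⟩ := exists_superset_card_eq_ne (B := ∅) (by simpa using ht0) ht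
    (argminScore k tie n y t)
  have : Nonempty {D : Finset (Fin M) // D ∈ subsetsOfSize M t ∧ D ≠ argminScore k tie n y t} :=
    ⟨⟨D, mem_subsetsOfSize.2 hD, hne⟩⟩
  obtain ⟨D', hD'⟩ := exists_eq_ciInf_of_finite
    (f := fun D : {D : Finset (Fin M) // D ∈ subsetsOfSize M t
      ∧ D ≠ argminScore k tie n y t} => score k n y D.1)
  exact ⟨D'.1, mem_subsetsOfSize.1 D'.2.1, D'.2.2, hD'⟩

/-- The event that one of the statistics outside a set `D ⊇ B` of size `t` is at least `lam`,
although all the sequences that it compares are nominal when `B` is the set of outliers. -/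
def nominalExceeds (k : ℝ → ℝ → ℝ) (B : Finset (Fin M)) (t : ℕ) (lam : ℝ) (n : ℕ) :
    Set (Path M) :=
  ⋃ D ∈ (subsetsOfSize M t).filter (B ⊆ ·), ⋃ j ∈ Dᶜ, {y | lam ≤ blockStat k D j n y}

/-- The event that, for some set `D ≠ B` of the size of `B`, the statistic of an outlier missed by
`D` is at most `lam`. -/
def outlierBelow (k : ℝ → ℝ → ℝ) (B : Finset (Fin M)) (lam : ℝ) (n : ℕ) : Set (Path M) :=
  ⋃ D ∈ (subsetsOfSize M B.card).filter (· ≠ B), ⋃ j ∈ B \ D, {y | blockStat k D j n y ≤ lam}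

theorem mem_nominalExceeds_of_score (hBD : B ⊆ D) (hD : D.card = t) (ht : t < M)
    (h : lam ≤ score k n y D) : y ∈ nominalExceeds k B t lam n := by
  obtain ⟨j, hj, hle⟩ := exists_le_blockStat (hD ▸ ht) h
  simp only [nominalExceeds, Set.mem_iUnion, Finset.mem_filter]
  exact ⟨D, ⟨mem_subsetsOfSize.2 hD, hBD⟩, j, by simpa using hj, hle⟩

theorem mem_nominalExceeds_of_secondScore (hBt : B.card < t) (ht : t < M)
    (h : lam ≤ secondScore k tie n y t) : y ∈ nominalExceeds k B t lam n := by
  obtain ⟨D, hBD, hD, hne⟩ := exists_superset_card_eq_ne hBt ht (argminScore k tie n y t)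
  exact mem_nominalExceeds_of_score hBD hD ht (h.trans (secondScore_le_score hD hne))

theorem mem_outlierBelow_of_secondScore (htie : IsTieBreak tie) (hB0 : 0 < B.card)
    (hBM : B.card < M) (h : secondScore k tie n y B.card ≤ lam) :
    y ∈ outlierBelow k B lam n := by
  -- if the second smallest score is attained at `B`, then the smallest one is attained elsewhere
  obtain ⟨D, hD, hne, hle⟩ : ∃ D : Finset (Fin M), D.card = B.card ∧ D ≠ B
      ∧ score k n y D ≤ lam := by
    obtain ⟨D, hD, hDI, hs⟩ := exists_score_eq_secondScore (k := k) (tie := tie) (n := n) (y := y)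
      hB0 hBM
    by_cases hDB : D = B
    · have hI := argminScore_mem_minimizers (k := k) (n := n) (y := y) htie hBM.le
      simp only [minimizers, Finset.mem_filter] at hI
      exact ⟨_, mem_subsetsOfSize.1 hI.1, fun h' => hDI (hDB.trans h'.symm),
        (argminScore_score_le htie hD).trans (hs.le.trans h)⟩
    · exact ⟨D, hD, hDB, hs.le.trans h⟩
  obtain ⟨j, hjB, hjD⟩ : ∃ j ∈ B, j ∉ D := by
    by_contra! hall
    exact hne (Finset.eq_of_subset_of_card_le hall hD.le).symm
  simp only [outlierBelow, Set.mem_iUnion, Finset.mem_filter]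
  exact ⟨D, ⟨mem_subsetsOfSize.2 hD, hne⟩, j, by simp [hjB, hjD],
    (blockStat_le_score hjD).trans hle⟩

theorem stopsAt_of_notMem (hM : 1 ≤ maxOutliers M) (htie : IsTieBreak tie) (hB0 : 0 < B.card)
    (hBT : B.card ≤ maxOutliers M) (hlow : y ∉ outlierBelow k B lam1 n)
    (hup : ∀ t ∈ Finset.Icc (B.card + 1) (maxOutliers M), y ∉ nominalExceeds k B t lam2 n) :
    StopsAt k tie lam1 lam2 n y := by
  have hTM := two_mul_maxOutliers_lt hM
  refine Or.inl ⟨B.card, Finset.mem_Icc.2 ⟨hB0, hBT⟩, ?_, fun t ht => ?_⟩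
  · by_contra! h
    exact hlow (mem_outlierBelow_of_secondScore htie hB0 (by omega) h)
  · by_contra! h
    have ht' := Finset.mem_Icc.1 ht
    exact hup t ht (mem_nominalExceeds_of_secondScore (by omega) (by omega) h)

theorem stopsAt_of_notMem_null (hM : 1 ≤ maxOutliers M)
    (hup : ∀ t ∈ Finset.Icc 1 (maxOutliers M), y ∉ nominalExceeds k ∅ t lam2 n) :
    StopsAt k tie lam1 lam2 n y := by
  have hTM := two_mul_maxOutliers_lt hM
  refine Or.inr fun t ht => ?_
  by_contra! h
  have ht' := Finset.mem_Icc.1 ht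
  exact hup t ht (mem_nominalExceeds_of_secondScore (by rw [Finset.card_empty]; omega)
    (by omega) h)

theorem exists_selects_of_decision_ne_none (h : decision k tie lam1 lam2 n y ≠ none) :
    ∃ t ∈ Finset.Icc 1 (maxOutliers M), Selects k tie lam1 lam2 n y t
      ∧ decision k tie lam1 lam2 n y = some (argminScore k tie n y t) := by
  classical
  unfold decision at h ⊢
  split_ifs at h ⊢ with h0
  · exact absurd rfl h
  · have hne : ((Finset.Icc 1 (maxOutliers M)).filter
        fun t => Selects k tie lam1 lam2 n y t).Nonempty := by
      by_contra hemp
      rw [Finset.not_nonempty_iff_eq_empty] at hemp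
      refine h0 ?_
      unfold estNum
      convert Finset.sup_empty
      rfl
    obtain ⟨t, ht, hsup⟩ := Finset.exists_mem_eq_sup _ hne id
    have hest : estNum k tie lam1 lam2 n y = t := by
      unfold estNum
      convert hsup
      rfl
    rw [Finset.mem_filter] at ht
    exact ⟨t, ht.1, ht.2, by rw [hest]⟩

theorem secondScore_lt_of_decision_eq_none (hs : StopsAt k tie lam1 lam2 n y)
    (h : decision k tie lam1 lam2 n y = none) :
    ∀ t ∈ Finset.Icc 1 (maxOutliers M), secondScore k tie n y t < lam2 := by
  classical
  rcases hs with ⟨t, ht, hsel⟩ | hs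
  · have h0 : estNum k tie lam1 lam2 n y = 0 := by
      by_contra h0
      simp [decision, h0] at h
    have : t ≤ estNum k tie lam1 lam2 n y := by
      unfold estNum
      exact Finset.le_sup (f := id) (Finset.mem_filter.2 ⟨ht, hsel⟩)
    have := (Finset.mem_Icc.1 ht).1
    omega
  · exact hs

/-- If the test decides for a wrong nonempty set of outliers, then either the estimated number of
outliers is at least the true one and nominal sequences look different, or it is smaller and an
outlier looks nominal. -/
theorem mem_of_misclassification (hM : 1 ≤ maxOutliers M) (htie : IsTieBreak tie)
    (hB0 : 0 < B.card) (hBT : B.card ≤ maxOutliers M)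
    (h : decision k tie lam1 lam2 n y ≠ some B) (h' : decision k tie lam1 lam2 n y ≠ none) :
    y ∈ (⋃ t ∈ Finset.Icc B.card (maxOutliers M), nominalExceeds k B t lam1 n)
      ∪ if 1 < B.card then outlierBelow k B lam2 n else ∅ := by
  have hTM := two_mul_maxOutliers_lt hM
  obtain ⟨t, ht, hsel, hd⟩ := exists_selects_of_decision_ne_none h'
  have ht' := Finset.mem_Icc.1 ht
  have hup : B.card ≤ t → y ∈ nominalExceeds k B t lam1 n →
      y ∈ (⋃ t ∈ Finset.Icc B.card (maxOutliers M), nominalExceeds k B t lam1 n)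
        ∪ if 1 < B.card then outlierBelow k B lam2 n else ∅ := fun hle hy =>
    Or.inl (Set.mem_biUnion (Finset.mem_Icc.2 ⟨hle, ht'.2⟩) hy)
  rcases lt_trichotomy t B.card with hlt | heq | hgt
  · refine Or.inr ?_
    rw [if_pos (by omega)]
    exact mem_outlierBelow_of_secondScore htie hB0 (by omega)
      (hsel.2 _ (Finset.mem_Icc.2 ⟨hlt, hBT⟩)).le
  · refine hup heq.ge (mem_nominalExceeds_of_score subset_rfl heq.symm (by omega)
      (hsel.1.le.trans (secondScore_le_score heq.symm fun hB => h ?_)))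
    rw [hd, ← hB]
  · exact hup hgt.le (mem_nominalExceeds_of_secondScore hgt (by omega) hsel.1.le)

end Scores

/-! ### Rates of the error events -/

section Rates

variable {M : ℕ} {k : ℝ → ℝ → ℝ} {fN fA : ℝ → ℝ} {B : Finset (Fin M)} {t : ℕ} {lam K : ℝ}
  [IsProbabilityMeasure (law fN)] [IsProbabilityMeasure (law fA)]

theorem expSmall_nominalExceeds (hM : 1 ≤ maxOutliers M) (hk : IsBoundedKernel k)
    (hK : ∀ x y, |k x y| ≤ K) (hK0 : 0 < K) (ht : t ≤ maxOutliers M) (hlam : 0 < lam) :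
    ExpSmall (hypLaw fN fA B) (nominalExceeds k B t lam)
      (lam ^ 2 / (32 * K ^ 2 * (1 + 1 / ((M : ℝ) - maxOutliers M - 1)))) := by
  have hTM := two_mul_maxOutliers_lt hM
  refine ExpSmall.biUnion _ fun D hD => ExpSmall.biUnion _ fun j hj => ?_
  obtain ⟨hDt, hBD⟩ := Finset.mem_filter.1 hD
  rw [mem_subsetsOfSize] at hDt
  rw [Finset.mem_compl] at hj
  have hr := card_compl_erase hj
  have hr0 : 0 < M - D.card - 1 := by omega
  refine (expSmall_le_blockStat hk hK hK0 hBD hj hr hr0 hlam).mono (fun n => subset_rfl) ?_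
  have hT : ((M : ℝ) - maxOutliers M - 1) = ((M - maxOutliers M - 1 : ℕ) : ℝ) := by
    rw [Nat.sub_sub, Nat.cast_sub (by omega)]; push_cast; ring
  have hT0 : (0 : ℝ) < ((M - maxOutliers M - 1 : ℕ) : ℝ) := by
    exact_mod_cast (by omega : 0 < M - maxOutliers M - 1)
  have hle : ((M - maxOutliers M - 1 : ℕ) : ℝ) ≤ ((M - D.card - 1 : ℕ) : ℝ) := by
    exact_mod_cast (by omega : M - maxOutliers M - 1 ≤ M - D.card - 1)
  rw [hT]
  gcongr

theorem expSmall_outlierBelow (hM : 1 ≤ maxOutliers M) (hk : IsBoundedKernel k)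
    (hK : ∀ x y, |k x y| ≤ K) (hK0 : 0 < K) (hB0 : 0 < B.card) (hBT : B.card ≤ maxOutliers M)
    {L : ℝ} (hL0 : 0 < L)
    (hL : L ≤ (1 - ((B.card : ℝ) - 1) / ((M : ℝ) - B.card - 1)) ^ 2 * mmdSq k fN fA)
    (hlam : lam < L) :
    ExpSmall (hypLaw fN fA B) (outlierBelow k B lam)
      ((L - lam) ^ 2 / (32 * K ^ 2 * (1 + 1 / ((M : ℝ) - B.card - 1)))) := by
  have hTM := two_mul_maxOutliers_lt hM
  refine ExpSmall.biUnion _ fun D hD => ExpSmall.biUnion _ fun j hj => ?_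
  obtain ⟨hDs, -⟩ := Finset.mem_filter.1 hD
  rw [mem_subsetsOfSize] at hDs
  obtain ⟨hjB, hjD⟩ := Finset.mem_sdiff.1 hj
  have hr := card_compl_erase hjD
  rw [hDs] at hr
  have hr0 : 0 < M - B.card - 1 := by omega
  have hrr : ((M : ℝ) - B.card - 1) = ((M - B.card - 1 : ℕ) : ℝ) := by
    rw [Nat.sub_sub, Nat.cast_sub (by omega)]; push_cast; ring
  rw [hrr] at hL ⊢
  set r := M - B.card - 1
  set v := ((Dᶜ.erase j).filter (· ∉ B)).card with hv
  -- at most `s - 1` of the sequences outside `D` other than the `j`-th one are outliers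
  have hv' : r ≤ v + (B.card - 1) := by
    have h1 := Finset.card_filter_add_card_filter_not (s := Dᶜ.erase j) (· ∈ B)
    have h2 : ((Dᶜ.erase j).filter (· ∈ B)).card ≤ (B.erase j).card :=
      Finset.card_le_card fun i hi => by
        simp only [Finset.mem_filter, Finset.mem_erase] at hi ⊢
        exact ⟨hi.1.1, hi.2⟩
    rw [Finset.card_erase_of_mem hjB] at h2
    omega
  have hr0' : (0 : ℝ) < r := by exact_mod_cast hr0
  have hv'' : (r : ℝ) ≤ v + ((B.card : ℝ) - 1) := by
    have : ((r : ℕ) : ℝ) ≤ ((v + (B.card - 1) : ℕ) : ℝ) := by exact_mod_cast hv'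
    rwa [Nat.cast_add, Nat.cast_sub hB0, Nat.cast_one] at this
  have hs : ((B.card : ℝ) - 1) ≤ r := by
    have : (B.card : ℝ) ≤ ((r + 1 : ℕ) : ℝ) := by
      exact_mod_cast (by omega : B.card ≤ r + 1)
    push_cast at this
    linarith
  have hmmd : 0 ≤ mmdSq k fN fA := by
    by_contra! hneg
    nlinarith [sq_nonneg (1 - ((B.card : ℝ) - 1) / r)]
  refine expSmall_blockStat_le hk hK hK0 hjB hr hr0 hv.symm hlam (hL.trans ?_)
  rw [mul_comm]
  refine mul_le_mul_of_nonneg_left ?_ hmmd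
  have h1 : 0 ≤ 1 - ((B.card : ℝ) - 1) / r := by
    rw [sub_nonneg, div_le_one hr0']; exact hs
  refine pow_le_pow_left₀ h1 ?_ 2
  rw [sub_le_iff_le_add, ← add_div, le_div_iff₀ hr0']
  linarith

end Rates

/-! ### Expected stopping times and error exponents -/

/-- Lowering the number of outliers from `s` to `s - 1` increases the threshold: as `M > 2 s`, the
squared factors are nonnegative. -/
theorem threshold_le {M : ℕ} {k : ℝ → ℝ → ℝ} {fN fA : ℝ → ℝ}
    (hM : 1 ≤ maxOutliers M) {s : ℕ} (hs : s ≤ maxOutliers M)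
    (h0 : 0 < threshold k M s fN fA) :
    threshold k M s fN fA ≤ (1 - ((s : ℝ) - 1) / ((M : ℝ) - s - 1)) ^ 2 * mmdSq k fN fA := by
  have hTM := two_mul_maxOutliers_lt hM
  have hsM : ((2 * s + 1 : ℕ) : ℝ) ≤ M := by exact_mod_cast (by omega : 2 * s + 1 ≤ M)
  have hsM' : ((s + 2 : ℕ) : ℝ) ≤ M := by exact_mod_cast (by omega : s + 2 ≤ M)
  push_cast at hsM hsM'
  have hr : (0 : ℝ) < (M : ℝ) - s - 1 := by linarith
  have hmmd : 0 ≤ mmdSq k fN fA := by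
    by_contra! hneg
    unfold threshold at h0
    nlinarith [sq_nonneg (1 - (s : ℝ) / ((M : ℝ) - s - 1))]
  unfold threshold
  have : 0 ≤ 1 - (s : ℝ) / ((M : ℝ) - s - 1) := by
    rw [sub_nonneg, div_le_one hr]; linarith
  gcongr
  linarith

section Exponents

variable {M : ℕ} {k : ℝ → ℝ → ℝ} {tie : Finset (Finset (Fin M)) → Finset (Fin M)}
  {lam1 lam2 : ℝ} {fN fA : ℝ → ℝ} {B : Finset (Fin M)} {L : ℝ}
  [IsProbabilityMeasure (law fN)] [IsProbabilityMeasure (law fA)]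

/-- A bound of the kernel that is positive even if the kernel vanishes. -/
theorem IsBoundedKernel.exists_pos_bound (hk : IsBoundedKernel k) :
    ∃ K, 0 < K ∧ ∀ x y, |k x y| ≤ K :=
  ⟨kernelSup k + 1, by
    have := (abs_nonneg _).trans (hk.abs_le_kernelSup 0 0)
    linarith, fun x y => (hk.abs_le_kernelSup x y).trans (by linarith)⟩

/-- If an exponent is positive, then so is `kernelSup k`, in view of `x / 0 = 0`. -/
theorem IsBoundedKernel.kernelSup_pos (hk : IsBoundedKernel k) {a b : ℝ}
    (h : 0 < a / (32 * kernelSup k ^ 2 * b)) : 0 < kernelSup k := by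
  refine lt_of_le_of_ne ((abs_nonneg _).trans (hk.abs_le_kernelSup 0 0)) fun h0 => ?_
  rw [← h0] at h
  simp at h

theorem rate_pos {M t : ℕ} {a K : ℝ} (ha : 0 < a) (hK : 0 < K) (ht : t + 1 < M) :
    0 < a ^ 2 / (32 * K ^ 2 * (1 + 1 / ((M : ℝ) - t - 1))) := by
  have : (0 : ℝ) < (M : ℝ) - t - 1 := by
    have : ((t + 1 : ℕ) : ℝ) < M := by exact_mod_cast ht
    push_cast at this
    linarith
  positivity

theorem eventually_expStop_le (hM : 1 ≤ maxOutliers M) (hk : IsBoundedKernel k)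
    (htie : IsTieBreak tie) (hlam2 : 0 < lam2) (hB0 : 0 < B.card) (hBT : B.card ≤ maxOutliers M)
    (hL : L ≤ (1 - ((B.card : ℝ) - 1) / ((M : ℝ) - B.card - 1)) ^ 2 * mmdSq k fN fA)
    (hL0 : 0 < L) (hlam : lam1 < L) :
    ∀ᶠ N : ℕ in atTop, expStop k tie lam1 lam2 fN fA B N ≤ N := by
  have hTM := two_mul_maxOutliers_lt hM
  obtain ⟨K, hK0, hK⟩ := hk.exists_pos_bound
  have h1 := expSmall_outlierBelow hM hk hK hK0 hB0 hBT hL0 hL hlam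
  have h2 := ExpSmall.biUnion (Finset.Icc (B.card + 1) (maxOutliers M))
    (E := fun t => nominalExceeds k B t lam2) (P := hypLaw fN fA B) fun t ht =>
    expSmall_nominalExceeds hM hk hK hK0 (Finset.mem_Icc.1 ht).2 hlam2
  refine expStop_le_of_expSmall ((h1.mono (fun n => subset_rfl) (min_le_left _ _)).union
    (h2.mono (fun n => subset_rfl) (min_le_right _ _)))
    (lt_min (rate_pos (by linarith) hK0 (by omega)) (rate_pos hlam2 hK0 (by omega)))
    fun n y hy => ?_
  rw [Set.mem_union, not_or] at hy
  exact stopsAt_of_notMem hM htie hB0 hBT hy.1 fun t ht h => hy.2 (Set.mem_biUnion ht h)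

theorem eventually_expStop_null_le (hM : 1 ≤ maxOutliers M) (hk : IsBoundedKernel k)
    (hlam2 : 0 < lam2) :
    ∀ᶠ N : ℕ in atTop, expStop k tie lam1 lam2 fN fA ∅ N ≤ N := by
  have hTM := two_mul_maxOutliers_lt hM
  obtain ⟨K, hK0, hK⟩ := hk.exists_pos_bound
  refine expStop_le_of_expSmall (ExpSmall.biUnion (Finset.Icc 1 (maxOutliers M))
    (E := fun t => nominalExceeds k ∅ t lam2) fun t ht =>
    expSmall_nominalExceeds hM hk hK hK0 (Finset.mem_Icc.1 ht).2 hlam2)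
    (rate_pos hlam2 hK0 (by omega)) fun n y hy => ?_
  exact stopsAt_of_notMem_null hM fun t ht h => hy (Set.mem_biUnion ht h)

theorem le_exponent_falseRejectProb (hM : 1 ≤ maxOutliers M) (hk : IsBoundedKernel k)
    (htie : IsTieBreak tie) (hlam2 : 0 < lam2) (hB0 : 0 < B.card) (hBT : B.card ≤ maxOutliers M)
    (hL : L ≤ (1 - ((B.card : ℝ) - 1) / ((M : ℝ) - B.card - 1)) ^ 2 * mmdSq k fN fA)
    (hlam1 : lam1 < L) (hlam : lam2 < lam1) :
    (((L - lam2) ^ 2 / (32 * kernelSup k ^ 2 * (1 + 1 / ((M : ℝ) - B.card - 1))) : ℝ) : EReal)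
      ≤ exponent (falseRejectProb k tie lam1 lam2 fN fA B)
          (expStop k tie lam1 lam2 fN fA B) := by
  have hTM := two_mul_maxOutliers_lt hM
  refine le_exponent_probDecide (E := outlierBelow k B lam2) (fun hpos =>
    expSmall_outlierBelow hM hk hk.abs_le_kernelSup (hk.kernelSup_pos hpos) hB0 hBT
      (by linarith) hL (by linarith)) (fun n y hs hd => ?_)
    (eventually_expStop_le hM hk htie hlam2 hB0 hBT hL (by linarith) hlam1)
  exact mem_outlierBelow_of_secondScore htie hB0 (by omega)
    (secondScore_lt_of_decision_eq_none hs hd _ (Finset.mem_Icc.2 ⟨hB0, hBT⟩)).le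

/-- The misclassification exponent, for a rate `g` that does not exceed the rate of
`outlierBelow` unless there is only one outlier. -/
theorem le_exponent_misclassProb (hM : 1 ≤ maxOutliers M) (hk : IsBoundedKernel k)
    (htie : IsTieBreak tie) (hlam2 : 0 < lam2) (hB0 : 0 < B.card) (hBT : B.card ≤ maxOutliers M)
    (hL : L ≤ (1 - ((B.card : ℝ) - 1) / ((M : ℝ) - B.card - 1)) ^ 2 * mmdSq k fN fA)
    (hlam1 : lam1 < L) (hlam : lam2 < lam1) {g : ℝ} (hg1 : g ≤ g1 k M lam1)
    (hg2 : 1 < B.card →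
      g ≤ (L - lam2) ^ 2 / (32 * kernelSup k ^ 2 * (1 + 1 / ((M : ℝ) - B.card - 1)))) :
    (g : EReal) ≤ exponent (misclassProb k tie lam1 lam2 fN fA B)
      (expStop k tie lam1 lam2 fN fA B) := by
  refine le_exponent_probDecide
    (E := fun n => (⋃ t ∈ Finset.Icc B.card (maxOutliers M), nominalExceeds k B t lam1 n)
      ∪ if 1 < B.card then outlierBelow k B lam2 n else ∅) (fun hpos => ?_) (fun n y _ hd => ?_)
    (eventually_expStop_le hM hk htie hlam2 hB0 hBT hL (by linarith) hlam1)
  · have hK0 := hk.kernelSup_pos (hpos.trans_le hg1)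
    refine ((ExpSmall.biUnion (Finset.Icc B.card (maxOutliers M))
      (E := fun t => nominalExceeds k B t lam1) fun t ht =>
      expSmall_nominalExceeds hM hk hk.abs_le_kernelSup hK0 (Finset.mem_Icc.1 ht).2
        (by linarith)).mono (fun n => subset_rfl) hg1).union ?_
    split_ifs with hs
    · exact (expSmall_outlierBelow hM hk hk.abs_le_kernelSup hK0 hB0 hBT (by linarith) hL
        (by linarith)).mono (fun n => subset_rfl) (hg2 hs)
    · exact fun g' _ => Eventually.of_forall fun n => by simp
  · exact mem_of_misclassification hM htie hB0 hBT hd.1 hd.2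

theorem le_exponent_falseAlarmProb (hM : 1 ≤ maxOutliers M) (hk : IsBoundedKernel k)
    (hlam2 : 0 < lam2) (hlam : lam2 < lam1) :
    ((g1 k M lam1 : ℝ) : EReal) ≤ exponent (falseAlarmProb k tie lam1 lam2 fN fA)
      (expStop k tie lam1 lam2 fN fA ∅) := by
  have hTM := two_mul_maxOutliers_lt hM
  refine le_exponent_probDecide
    (E := fun n => ⋃ t ∈ Finset.Icc 1 (maxOutliers M), nominalExceeds k ∅ t lam1 n)
    (fun hpos => ExpSmall.biUnion (Finset.Icc 1 (maxOutliers M))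
      (E := fun t => nominalExceeds k ∅ t lam1) fun t ht => ?_) (fun n y _ hd => ?_)
    (eventually_expStop_null_le hM hk hlam2)
  · exact expSmall_nominalExceeds hM hk hk.abs_le_kernelSup (hk.kernelSup_pos hpos)
      (Finset.mem_Icc.1 ht).2 (by linarith)
  · obtain ⟨t, ht, hsel, -⟩ := exists_selects_of_decision_ne_none hd
    have ht' := Finset.mem_Icc.1 ht
    exact Set.mem_biUnion ht (mem_nominalExceeds_of_secondScore
      (by rw [Finset.card_empty]; omega) (by omega) hsel.1.le)

end Exponents

end OutlierTest

open OutlierTest in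
theorem theorem5 (M : ℕ) (hM : 1 ≤ maxOutliers M)
    (k : ℝ → ℝ → ℝ) (hk : IsBoundedKernel k)
    (tie : Finset (Finset (Fin M)) → Finset (Fin M)) (htie : IsTieBreak tie)
    (fN fA : ℝ → ℝ) (hfN : IsPDF fN) (hfA : IsPDF fA)
    (lam1 lam2 : ℝ) (hlam2 : 0 < lam2) (hlam : lam2 < lam1) :
    -- expected stopping time under non-null hypotheses
    (∀ s : ℕ, 1 < s → s ≤ maxOutliers M →
      ∀ᶠ N : ℕ in atTop, ∀ B ∈ subsetsOfSize M s,
        expStop k tie lam1 lam2 fN fA B N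
          ≤ if lam1 < threshold k M s fN fA then (N : ℝ≥0∞) else ⊤) ∧
    (∀ᶠ N : ℕ in atTop, ∀ B ∈ subsetsOfSize M 1,
        expStop k tie lam1 lam2 fN fA B N
          ≤ if lam1 < mmdSq k fN fA then (N : ℝ≥0∞) else ⊤) ∧
    -- expected stopping time under the null hypothesis
    (∀ᶠ N : ℕ in atTop, expStop k tie lam1 lam2 fN fA ∅ N ≤ (N : ℝ≥0∞)) ∧
    -- misclassification and false reject exponents for more than one outlier
    (∀ s : ℕ, 1 < s → s ≤ maxOutliers M → lam1 < threshold k M s fN fA →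
      ∀ B ∈ subsetsOfSize M s,
        ((min (g1 k M lam1) (g2 k M s fN fA lam2) : ℝ) : EReal)
            ≤ exponent (misclassProb k tie lam1 lam2 fN fA B)
                (expStop k tie lam1 lam2 fN fA B) ∧
        ((g2 k M s fN fA lam2 : ℝ) : EReal)
            ≤ exponent (falseRejectProb k tie lam1 lam2 fN fA B)
                (expStop k tie lam1 lam2 fN fA B)) ∧
    -- misclassification and false reject exponents for one outlier
    (lam1 < mmdSq k fN fA →
      ∀ B ∈ subsetsOfSize M 1,
        ((g1 k M lam1 : ℝ) : EReal)
            ≤ exponent (misclassProb k tie lam1 lam2 fN fA B)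
                (expStop k tie lam1 lam2 fN fA B) ∧
        (((mmdSq k fN fA - lam2) ^ 2
              / (32 * kernelSup k ^ 2 * (1 + 1 / ((M : ℝ) - 2))) : ℝ) : EReal)
            ≤ exponent (falseRejectProb k tie lam1 lam2 fN fA B)
                (expStop k tie lam1 lam2 fN fA B)) ∧
    -- false alarm exponent
    ((g1 k M lam1 : ℝ) : EReal)
      ≤ exponent (falseAlarmProb k tie lam1 lam2 fN fA)
          (expStop k tie lam1 lam2 fN fA ∅) := by
  have := hfN.isProbabilityMeasure_law
  have := hfA.isProbabilityMeasure_law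
  have hone : ∀ {B : Finset (Fin M)}, B.card = 1 →
      mmdSq k fN fA ≤ (1 - ((B.card : ℝ) - 1) / ((M : ℝ) - B.card - 1)) ^ 2 * mmdSq k fN fA :=
    fun hB => by simp [hB]
  refine ⟨fun s hs hsT => ?_, ?_, eventually_expStop_null_le hM hk hlam2,
    fun s hs hsT hlt B hB => ?_, fun hlt B hB => ?_, le_exponent_falseAlarmProb hM hk hlam2 hlam⟩
  · split_ifs with hlt
    · refine (Filter.eventually_all_finset _).2 fun B hB => ?_
      obtain rfl := mem_subsetsOfSize.1 hB
      exact eventually_expStop_le hM hk htie hlam2 (by omega) hsT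
        (threshold_le hM hsT (by linarith)) (by linarith) hlt
    · exact Filter.Eventually.of_forall fun N B _ => le_top
  · split_ifs with hlt
    · refine (Filter.eventually_all_finset _).2 fun B hB => ?_
      have hB1 := mem_subsetsOfSize.1 hB
      exact eventually_expStop_le hM hk htie hlam2 (by omega) (by omega) (hone hB1)
        (by linarith) hlt
    · exact Filter.Eventually.of_forall fun N B _ => le_top
  · obtain rfl := mem_subsetsOfSize.1 hB
    have hL := threshold_le hM hsT (hlam2.trans (hlam.trans hlt))
    exact ⟨le_exponent_misclassProb hM hk htie hlam2 (by omega) hsT hL hlt hlam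
      (min_le_left _ _) fun _ => min_le_right _ _,
      le_exponent_falseRejectProb hM hk htie hlam2 (by omega) hsT hL hlt hlam⟩
  · have hB1 := mem_subsetsOfSize.1 hB
    refine ⟨le_exponent_misclassProb hM hk htie hlam2 (by omega) (by omega) (hone hB1) hlt hlam
      le_rfl fun h => absurd h (by omega), ?_⟩
    have h := le_exponent_falseRejectProb hM hk htie hlam2 (by omega) (by omega) (hone hB1)
      hlt hlam
    rw [hB1, Nat.cast_one, sub_sub, one_add_one_eq_two] at h
    exact h
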